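/- **Game.** Two players $i\in\{1,2\}$ interact in periods $t=1,2,\dots$. The state $\theta\in\{H,L\}$ is drawn once, with $\mathbb P(\theta=H)=p_0\in(0,1)$. In every period $t$ each player $i$ receives a private signal $x_{it}$ in a finite set $X$ and then chooses an action $a_{it}\in\{I,N\}$; conditional on $\theta$, signals are independent across players and periods with law $f_\theta$, where $f_H\neq f_L$ and $f_\theta(x)>0$ for all $\theta$ and $x$. Actions are publicly observed, payoffs are not. The stage payoff $u_i(a,\theta)$ is $0$ if $a_i=N$; if $a_i=I$ it is $1-c$ when $\theta=H$ and $a=(I,I)$, and $-c$ otherwise. A pure strategy $s_i$ of player $i$ maps each private history $(a^{t-1},x_i^t)$, where $a^{t-1}=(a_1,\dots,a_{t-1})$ and $x_i^t=(x_{i1},\dots,x_{it})$, to an action. A mixed strategy $\sigma_i$ is a Borel probability measure on the space of pure strategies (with the product topology), and the players randomize independently. A profile $\sigma$ induces a law $\mathbb P_\sigma$ on paths (state, signals, actions), and player $i$'s payoff is $\mathbb E_\sigma\big[\sum_{t\ge1}(1-\delta)\delta^{t-1}u_i(a_t,\theta)\big]$. **Cool-off scheme.** A function $T:\mathbb N\to\mathbb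 N$ divides action histories into cool-off and investment histories, recursively. The empty history is a cool-off history. If $a^{t-1}$ is an investment history, then $a^t$ is one if and only if $a_t=(I,I)$. If $a^{t-1}$ is a cool-off history and $a^{s-1}$ is its longest initial segment that is an investment history, then $a^t$ is an investment history if and only if $t>s+T(s)-1$. If $a^{t-1}$ is a cool-off history with no initial segment that is an investment history, then $a^t$ is an investment history if and only if $t>T(1)$. Call an action history $a^{t-1}$ *violated* if for some $\tau<t$ the history $a^{\tau-1}$ is a cool-off history and some player chose $I$ in period $\tau$. **Cool-off strategies.** Let $\Sigma_i(T)$ be the set of mixed strategies of player $i$ whose support contains only pure strategies that play $N$ at every private history whose action history is a cool-off history or is violated. A private history $(a^{t-1},x_i^t)$ is consistent with a pure strategy $s_i$ if $s_i(a^{\tau-1},x_i^\tau)=a_{i\tau}$ for all $\tau<t$. It is consistent with $\sigma_i$ if it is consistent with some $s_i$ in the support of $\sigma_i$. An action history $a^{t-1}$ is consistent with $\sigma_i$ if $(a^{t-1},x_i^t)$ is, for some $x_i^t$ of positive probability. Write $\sigma_i(a^{t-1},x_i^t)(b)$ for the $\sigma_i$-probability that $s_i(a^{t-1},x_i^t)=b$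 conditional on $s_i$ being consistent with $(a^{t-1},x_i^t)$, and for $a^{t-1}$ consistent with $\sigma_i$ put $$\sigma_i(a^{t-1})(I\mid H)=\frac{\sum_{x_i^t\in X^t}\big(\prod_{\tau\le t}f_H(x_{i\tau})\big)\big(\prod_{\tau<t}\sigma_i(a^{\tau-1},x_i^\tau)(a_{i\tau})\big)\,\sigma_i(a^{t-1},x_i^t)(I)}{\sum_{x_i^t\in X^t}\big(\prod_{\tau\le t}f_H(x_{i\tau})\big)\prod_{\tau<t}\sigma_i(a^{\tau-1},x_i^\tau)(a_{i\tau})},$$ where a product that contains an undefined factor is read as $0$. For $\varepsilon>0$, let $\Sigma_i(T,\varepsilon)$ be the set of $\sigma_i\in\Sigma_i(T)$ such that $\sigma_i(a^{t-1})(I\mid H)\ge1-\varepsilon$ for every investment history $a^{t-1}$ that is not violated and is consistent with $\sigma_i$. Let $\mathcal S(T,\varepsilon)=\Sigma_1(T,\varepsilon)\times\Sigma_2(T,\varepsilon)$. **Theorem (Action Efficiency).** Let $X$, $p_0$, $f_H$, $f_L$ be as above. For all $c,\delta\in(0,1)$ there exist a function $T:\mathbb N\to\mathbb N$ and an $\varepsilon>0$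 such that the following holds. Let $\sigma^*$ be any Nash equilibrium of the game restricted to $\mathcal S(T,\varepsilon)$, that is, any $\sigma^*\in\mathcal S(T,\varepsilon)$ such that no player $i$ can increase their payoff by deviating to another strategy in $\Sigma_i(T,\varepsilon)$. Then, $\mathbb P_{\sigma^*}$-almost surely, the action profile $a_t$ converges as $t\to\infty$ to $(I,I)$ if $\theta=H$ and to $(N,N)$ if $\theta=L$. -/

import Mathlib

namespace CoolOff

open MeasureTheory

/-- The two states of nature. -/
inductive State
  | H
  | L
  deriving DecidableEq

/-- The two actions: invest (`I`) and not invest (`N`). -/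
inductive Act
  | I
  | N
  deriving DecidableEq

instance : Fintype State := ⟨{State.H, State.L}, fun θ => by cases θ <;> simp⟩
instance : Fintype Act := ⟨{Act.I, Act.N}, fun a => by cases a <;> simp⟩
instance : MeasurableSpace State := ⊤
instance : DiscreteMeasurableSpace State := ⟨fun _ => trivial⟩
instance : MeasurableSpace Act := ⊤
instance : DiscreteMeasurableSpace Act := ⟨fun _ => trivial⟩
instance : TopologicalSpace Act := ⊥
instance : DiscreteTopology Act := ⟨rfl⟩

/-- The two players. -/
abbrev Player := Fin 2

/-- Action profiles. -/
abbrev Profile := Player → Act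

/-- The profile `(I, I)`. -/
def bothI : Profile := fun _ => Act.I

/-- The profile `(N, N)`. -/
def bothN : Profile := fun _ => Act.N

/-- Action histories `a^t = (a_1, …, a_t)` of length `t`; the entry with index `k : Fin t` is the
profile played in period `k + 1`. -/
abbrev ActHist (t : ℕ) := Fin t → Profile

/-- Private histories of a player: a public action history `a^t` of length `t`, together with the
`t + 1` private signals received up to and including period `t + 1`. The player then acts in
period `t + 1`. -/
abbrev PrivHist (X : Type*) := Σ t : ℕ, ActHist t × (Fin (t + 1) → X)

/-- Pure strategies, with the product topology and product (= Borel) σ-algebra. -/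
abbrev PureStrategy (X : Type*) := PrivHist X → Act

/-- Mixed strategies: probability measures on the space of pure strategies. -/
abbrev MixedStrategy (X : Type*) := ProbabilityMeasure (PureStrategy X)

/-- The stage payoff `u_i(a, θ)`: not investing yields `0`; investing yields `1 - c` if the state
is `H` and both players invest, and `-c` otherwise. -/
noncomputable def stagePayoff (c : ℝ) (a : Profile) (θ : State) (i : Player) : ℝ :=
  if a i = Act.I then (if θ = State.H ∧ a = bothI then 1 - c else -c) else 0

section Scheme

/-- `IsInv T t a`: the action history `a = a^t` is an investment history of the cool-off scheme
induced by the cool-off function `T`; otherwise it is a cool-off history.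

* The empty history is a cool-off history.
* If `a^t` is an investment history, then so is `a^{t+1}` if and only if `a_{t+1} = (I, I)`.
* Suppose that `a^t` is a cool-off history and that `a^r` is the longest initial segment that is an
  investment history; put `s = r + 1`. Then `a^{t+1}` is an investment history if and only if
  `t + 1 > s + T s - 1`.
* Suppose that `a^t` is a cool-off history and no initial segment is an investment history. Then
  `a^{t+1}` is an investment history if and only if `t + 1 > T 1`. -/
def IsInv (T : ℕ → ℕ) : (t : ℕ) → ActHist t → Prop
  | 0, _ => False
  | t + 1, a =>
      (IsInv T t (Fin.take t (Nat.le_succ t) a) ∧ a (Fin.last t) = bothI) ∨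
      (¬ IsInv T t (Fin.take t (Nat.le_succ t) a) ∧
        ((∃ (r : ℕ) (hr : r ≤ t),
            IsInv T r (Fin.take r (hr.trans (Nat.le_succ t)) a) ∧
            (∀ (r' : ℕ) (hr' : r' ≤ t), r < r' →
              ¬ IsInv T r' (Fin.take r' (hr'.trans (Nat.le_succ t)) a)) ∧
            (r + 1) + T (r + 1) - 1 < t + 1) ∨
         ((∀ (r : ℕ) (hr : r ≤ t), ¬ IsInv T r (Fin.take r (hr.trans (Nat.le_succ t)) a)) ∧
            T 1 < t + 1)))
  termination_by t => t

/-- In the action history `a`, some player chose `I` during a cool-off phase. -/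
def CoolOffViolated (T : ℕ → ℕ) {t : ℕ} (a : ActHist t) : Prop :=
  ∃ k : Fin t, ¬ IsInv T k (Fin.take k k.isLt.le a) ∧ ∃ j : Player, a k j = Act.I

end Scheme

section Strategies

variable {X : Type*}

/-- The private history at which a player acted in period `k + 1`, on the way to the private
history `(a, x)`. -/
def pastHist {t : ℕ} (a : ActHist t) (x : Fin (t + 1) → X) (k : Fin t) : PrivHist X :=
  ⟨k, Fin.take k k.isLt.le a, Fin.take (k + 1) (Nat.succ_le_succ k.isLt.le) x⟩

/-- The set `S_i(T)` of pure strategies that play `N` at every cool-off history, and also at every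
action history in which some player chose `I` during a cool-off phase. -/
def pureCoolOff (X : Type*) (T : ℕ → ℕ) : Set (PureStrategy X) :=
  {s | ∀ (t : ℕ) (a : ActHist t) (x : Fin (t + 1) → X),
    (¬ IsInv T t a ∨ CoolOffViolated T a) → s ⟨t, a, x⟩ = Act.N}

/-- The private history `(a, x)` of player `i` is consistent with the pure strategy `s`. -/
def ConsistentPure (i : Player) (s : PureStrategy X) {t : ℕ} (a : ActHist t)
    (x : Fin (t + 1) → X) : Prop :=
  ∀ k : Fin t, s (pastHist a x k) = a k i

/-- The private history `(a, x)` of player `i` is consistent with the mixed strategy `σ`: it is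
consistent with some pure strategy in the topological support of `σ`. -/
def ConsistentMixed (i : Player) (σ : MixedStrategy X) {t : ℕ} (a : ActHist t)
    (x : Fin (t + 1) → X) : Prop :=
  ∃ s ∈ (σ : Measure (PureStrategy X)).support, ConsistentPure i s a x

/-- The conditional probability `σ_i(a, x)(b)` with which player `i`, using the mixed strategy `σ`,
takes the action `b` at the private history `(a, x)`. -/
noncomputable def behavior (i : Player) (σ : MixedStrategy X) (h : PrivHist X) (b : Act) : ℝ :=
  (σ : Measure (PureStrategy X)).real {s | ConsistentPure i s h.2.1 h.2.2 ∧ s h = b} /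
    (σ : Measure (PureStrategy X)).real {s | ConsistentPure i s h.2.1 h.2.2}

/-- The probability, under the signal distribution `g`, of a finite string of signals. -/
noncomputable def signalProb (g : PMF X) {n : ℕ} (x : Fin n → X) : ℝ :=
  ∏ k, (g (x k)).toReal

/-- The action history `a` is consistent with `σ`: for some signals of positive probability under
`g`, the private history `(a, x)` is consistent with `σ`. -/
def ConsistentAct (g : PMF X) (i : Player) (σ : MixedStrategy X) {t : ℕ} (a : ActHist t) : Prop :=
  ∃ x : Fin (t + 1) → X, 0 < signalProb g x ∧ ConsistentMixed i σ a x

/-- The conditional probability `σ_i(a)(I | θ)` of investing at the action history `a`, when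
signals are distributed according to `g = f_θ`. -/
noncomputable def investProb [Fintype X] (g : PMF X) (i : Player) (σ : MixedStrategy X) {t : ℕ}
    (a : ActHist t) : ℝ :=
  (∑ x : Fin (t + 1) → X, signalProb g x *
      ((∏ k : Fin t, behavior i σ (pastHist a x k) (a k i)) * behavior i σ ⟨t, a, x⟩ Act.I)) /
    (∑ x : Fin (t + 1) → X, signalProb g x *
      (∏ k : Fin t, behavior i σ (pastHist a x k) (a k i)))

/-- The set `Σ_i(T)` of mixed strategies supported in `S_i(T)`. -/
def mixedCoolOff (X : Type*) (T : ℕ → ℕ) : Set (MixedStrategy X) :=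
  {σ | (σ : Measure (PureStrategy X)).support ⊆ pureCoolOff X T}

/-- The set `Σ_i(T, ε)` of cool-off strategies of player `i`: elements of `Σ_i(T)` that, conditional
on the state `H`, invest with probability at least `1 - ε` at every investment history that is
consistent with the strategy and in which nobody has invested during a cool-off phase. (At
histories in which somebody has, membership in `Σ_i(T)` prescribes `N`.) -/
def coolOffStrategies [Fintype X] (f : State → PMF X) (T : ℕ → ℕ) (ε : ℝ) (i : Player) :
    Set (MixedStrategy X) :=
  {σ | σ ∈ mixedCoolOff X T ∧
    ∀ (t : ℕ) (a : ActHist t), IsInv T t a → ¬ CoolOffViolated T a →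
      ConsistentAct (f State.H) i σ a → 1 - ε ≤ investProb (f State.H) i σ a}

end Strategies

section Paths

variable {X : Type*}

/-- Paths of the repeated interaction: the state, all signals, all actions. Index `t` stands for
period `t + 1`. -/
abbrev PathSpace (X : Type*) := State × (ℕ → Player → X) × (ℕ → Profile)

/-- The profile chosen after the action history `a`, given pure strategies and signals. -/
def nextProfile (s : Player → PureStrategy X) (x : ℕ → Player → X) {t : ℕ} (a : ActHist t) :
    Profile :=
  fun i => s i ⟨t, a, fun k => x k i⟩

/-- The action history of length `t` generated by pure strategies and signals. -/
def playHist (s : Player → PureStrategy X) (x : ℕ → Player → X) : (t : ℕ) → ActHist t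
  | 0 => Fin.elim0
  | t + 1 => Fin.snoc (α := fun _ => Profile) (playHist s x t) (nextProfile s x (playHist s x t))

/-- The path generated by the state `θ`, the signals and the pure strategies. -/
def outcome (θ : State) (w : (ℕ → Player → X) × (Player → PureStrategy X)) : PathSpace X :=
  (θ, w.1, fun t => nextProfile w.2 w.1 (playHist w.2 w.1 t))

variable [MeasurableSpace X]

/-- The law of the path in the state `θ`: signals are i.i.d. with law `f θ` across players and
periods, the players draw their pure strategies independently of each other and of the signals. -/
noncomputable def pathLawGiven (f : State → PMF X) (σ : Player → MixedStrategy X) (θ : State) :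
    Measure (PathSpace X) :=
  ((Measure.infinitePi fun _ : ℕ => Measure.pi fun _ : Player => (f θ).toMeasure).prod
    (Measure.pi fun i => (σ i : Measure (PureStrategy X)))).map (outcome θ)

/-- The law `ℙ_σ` of the path, where `p₀` is the prior probability of the state `H`. -/
noncomputable def pathLaw (p₀ : ℝ) (f : State → PMF X) (σ : Player → MixedStrategy X) :
    Measure (PathSpace X) :=
  ENNReal.ofReal p₀ • pathLawGiven f σ State.H + ENNReal.ofReal (1 - p₀) • pathLawGiven f σ State.L

/-- The long-run expected payoff of player `i`. -/
noncomputable def payoff (p₀ : ℝ) (f : State → PMF X) (c δ : ℝ) (σ : Player → MixedStrategy X)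
    (i : Player) : ℝ :=
  ∫ ω, ∑' t : ℕ, (1 - δ) * δ ^ t * stagePayoff c (ω.2.2 t) ω.1 i ∂(pathLaw p₀ f σ)

/-- Nash equilibria of the game in which each player `i` is restricted to the strategy set `S i`. -/
def IsRestrictedEquilibrium (p₀ : ℝ) (f : State → PMF X) (c δ : ℝ)
    (S : Player → Set (MixedStrategy X)) (σ : Player → MixedStrategy X) : Prop :=
  (∀ i, σ i ∈ S i) ∧
    ∀ i, ∀ τ ∈ S i, payoff p₀ f c δ (Function.update σ i τ) i ≤ payoff p₀ f c δ σ i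

end Paths

end CoolOff

/-! Conditional on the state, the probability of an action history and of the private signals
factors over the players. The odds of player `i` between the states are therefore the prior odds,
times the likelihood ratio of the own signals, times that of the opponent's actions; the own
strategy cancels (`stateWeight`). A player is confident of a state when the odds against it are at
most a small `κ`.

Incentives. Compare a strategy that plays `N` at an investment history, while confident of `H`, with
investing from then on. In state `H` the opponent invests with probability at least `1 - ε`, so
investing earns at least `1 - ε - c > 0` at once and nothing negative in expectation later. The
choice of `N` earns nothing for the whole cool-off phase that it triggers. State `L` costs at most a
`κ`-share. With long cool-off phases the switch is profitable (`payoff_switch_high`). If a player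
invests while confident of `L`, abstaining forever saves `c` at once and forgoes at most a `κ`-share
(`payoff_switch_low`).

Feasibility. Deviations must respect the investment constraint. Signals received during a long
cool-off phase make a player confident of `H` except on a set of `H`-probability at most `ε`,
relative to the probability of the history, whatever happened before the phase. The Bhattacharyya
coefficient `r = ∑ √(f_H f_L) < 1` measures this: `T` periods contribute `r ^ T`, while signals up
to time `q` can only contribute powers of a bound `K` on `f_L / f_H`. The inequality `r ≤ (1 - ε) ^
2` preserves the estimate during the following investment phase. So a strategy that invests whenever
confident of `H` is feasible (`constraint_of_invest_high`, `mixedSwitch_high_mem`). The deviation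
for `L` may be infeasible by itself; applying the deviation for `H` on top repairs it without
lowering the payoff. In equilibrium both kinds of switch thus have probability zero in the state
concerned.

Learning. The probability of not being confident of the true state decays like `r ^ t` for every
strategy profile (`not_confident_le`). By Borel–Cantelli the players are eventually always confident
of the truth. In `L` they eventually stop investing. In `H` they eventually invest at every
investment history; such histories always recur, and joint investment then never ends. -/

namespace CoolOff

open MeasureTheory

/-! ### Prefixes of infinite sequences -/

/-- The first `n` entries of an infinite sequence. -/
def pre {α : Type*} (u : ℕ → α) (n : ℕ) : Fin n → α := fun k => u k

/-- Lets finite histories be treated as prefixes of infinite sequences, for which taking initial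
segments is definitional (`take_pre`). -/
lemma exists_pre_eq {α : Type*} [Nonempty α] {n : ℕ} (a : Fin n → α) : ∃ u, pre u n = a := by
  refine ⟨fun k => if h : k < n then a ⟨k, h⟩ else Classical.arbitrary α, ?_⟩
  funext k
  simp [pre]

lemma take_pre {α : Type*} (u : ℕ → α) {m n : ℕ} (h : m ≤ n) :
    Fin.take m h (pre u n) = pre u m := rfl

lemma pre_congr {α : Type*} {u v : ℕ → α} {n : ℕ} (h : ∀ k < n, u k = v k) :
    pre u n = pre v n := funext fun k => h k k.isLt

lemma pre_eq_iff {α : Type*} {u v : ℕ → α} {n : ℕ} : pre u n = pre v n ↔ ∀ k < n, u k = v k :=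
  ⟨fun h k hk => congrFun h ⟨k, hk⟩, pre_congr⟩

lemma snoc_pre {α : Type*} (u : ℕ → α) (n : ℕ) :
    Fin.snoc (α := fun _ => α) (pre u n) (u n) = pre u (n + 1) := by
  funext k
  refine Fin.lastCases ?_ (fun k => ?_) k
  · simp [pre]
  · simp [pre]

/-- The private history after the actions `a` and own signals `x` before acting in period
`t + 1`. -/
def node {X : Type*} (a : ℕ → Profile) (x : ℕ → X) (t : ℕ) : PrivHist X :=
  ⟨t, pre a t, pre x (t + 1)⟩

/-! ### Combinatorics of the cool-off scheme -/

section Scheme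

variable {T : ℕ → ℕ} {a : ℕ → Profile}

lemma not_isInv_zero (a : ActHist 0) : ¬ IsInv T 0 a := by
  rw [IsInv]; exact id

lemma isInv_succ_iff {t : ℕ} : IsInv T (t + 1) (pre a (t + 1)) ↔
    (IsInv T t (pre a t) ∧ a t = bothI) ∨
      (¬ IsInv T t (pre a t) ∧
        ((∃ r ≤ t, IsInv T r (pre a r) ∧ (∀ r' ≤ t, r < r' → ¬ IsInv T r' (pre a r')) ∧
            (r + 1) + T (r + 1) - 1 < t + 1) ∨
          ((∀ r ≤ t, ¬ IsInv T r (pre a r)) ∧ T 1 < t + 1))) := by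
  rw [IsInv]
  simp only [take_pre, exists_prop]
  rfl

lemma isInv_succ_of_isInv {t : ℕ} (h : IsInv T t (pre a t)) :
    IsInv T (t + 1) (pre a (t + 1)) ↔ a t = bothI := by
  rw [isInv_succ_iff]; tauto

lemma violated_pre_iff {t : ℕ} : CoolOffViolated T (pre a t) ↔
    ∃ k < t, ¬ IsInv T k (pre a k) ∧ ∃ j, a k j = Act.I :=
  ⟨fun ⟨k, h⟩ => ⟨k, k.isLt, h⟩, fun ⟨k, hk, h⟩ => ⟨⟨k, hk⟩, h⟩⟩

lemma not_violated_mono {s t : ℕ} (hst : s ≤ t) (h : ¬ CoolOffViolated T (pre a t)) :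
    ¬ CoolOffViolated T (pre a s) := by
  rw [violated_pre_iff] at *
  exact fun ⟨k, hk, h'⟩ => h ⟨k, hk.trans_le hst, h'⟩

lemma eq_N_iff {b : Act} : b = Act.N ↔ b ≠ Act.I := by cases b <;> simp

lemma eq_I_iff {b : Act} : b = Act.I ↔ b ≠ Act.N := by cases b <;> simp

lemma eq_N_of_not_violated {s t : ℕ} (hst : s < t) (h : ¬ CoolOffViolated T (pre a t))
    (hs : ¬ IsInv T s (pre a s)) (j : Player) : a s j = Act.N := by
  rw [violated_pre_iff] at h
  rw [eq_N_iff]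
  exact fun hj => h ⟨s, hst, hs, j, hj⟩

/-- After an investment history at which somebody did not invest, the following histories are
cool-off histories for as long as the cool-off function prescribes. -/
lemma not_isInv_of_le {m : ℕ} (hm : IsInv T m (pre a m)) (ha : a m ≠ bothI) {k : ℕ}
    (hk : k < T (m + 1)) : ¬ IsInv T (m + 1 + k) (pre a (m + 1 + k)) := by
  induction k using Nat.strong_induction_on with
  | _ k ih =>
    rcases k with _ | k
    · rw [add_zero, isInv_succ_of_isInv hm]; exact ha
    · intro h
      rw [← add_assoc, isInv_succ_iff] at h
      rcases h with h | ⟨h0, ⟨r, hr, hr1, hr2, hr3⟩ | ⟨h1, -⟩⟩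
      · exact ih k (by omega) (by omega) h.1
      · have hrm : r = m := by
          rcases lt_trichotomy r m with h | h | h
          · exact absurd hm (hr2 m (by omega) h)
          · exact h
          · obtain ⟨d, rfl⟩ := Nat.exists_eq_add_of_le (show m + 1 ≤ r from h)
            exact absurd hr1 (ih d (by omega) (by omega))
        subst hrm
        omega
      · exact h1 m (by omega) hm

/-- Before an investment history of length `t` there was a cool-off phase between `q` and `p`,
followed by joint investment until `t`. -/
lemma exists_phase {t : ℕ} (h : IsInv T t (pre a t)) : ∃ q p, q + T (max q 1) ≤ p ∧ p ≤ t ∧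
    (∀ k, q ≤ k → k < p → ¬ IsInv T k (pre a k)) ∧
    (∀ k, p ≤ k → k < t → IsInv T k (pre a k) ∧ a k = bothI) := by
  induction t with
  | zero => exact absurd h (not_isInv_zero _)
  | succ t ih =>
    rcases isInv_succ_iff.1 h with ⟨h1, h2⟩ | ⟨h0, ⟨r, hr, hr1, hr2, hr3⟩ | ⟨h1, h2⟩⟩
    · obtain ⟨q, p, hqp, hpt, hc, hi⟩ := ih h1
      refine ⟨q, p, hqp, by omega, hc, fun k hk hkt => ?_⟩
      rcases Nat.lt_succ_iff_lt_or_eq.1 hkt with h | rfl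
      · exact hi k hk h
      · exact ⟨h1, h2⟩
    -- A phase triggered at `a^r` starts at length `q = r + 1` and is governed by `T q`. The initial
    -- phase starts at `q = 0` but is governed by `T 1`; hence `max q 1`.
    · refine ⟨r + 1, t + 1, ?_, le_rfl, fun k hk hkt => hr2 k (by omega) (by omega),
        fun k hk hkt => by omega⟩
      rw [max_eq_left (by omega)]; omega
    · refine ⟨0, t + 1, ?_, le_rfl, fun k hk hkt => h1 k (by omega), fun k hk hkt => by omega⟩
      simp only [zero_le, max_eq_right]; omega

/-- Cool-off phases are finite: if no investment history had length at least `t₀`, there would be a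
last one or none at all, and the scheme would produce another after the prescribed wait. -/
lemma exists_isInv_ge (t₀ : ℕ) : ∃ t ≥ t₀, IsInv T t (pre a t) := by
  by_contra! hno
  by_cases h : ∃ r, IsInv T r (pre a r)
  · classical
    obtain ⟨r, hr, hmax⟩ : ∃ r, IsInv T r (pre a r) ∧ ∀ r', r < r' → ¬ IsInv T r' (pre a r') := by
      obtain ⟨r₀, hr₀⟩ := h
      refine ⟨Nat.findGreatest (fun r => IsInv T r (pre a r)) t₀,
        Nat.findGreatest_spec (P := fun r => IsInv T r (pre a r)) (m := r₀) ?_ hr₀, ?_⟩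
      · by_contra! hlt; exact hno _ hlt.le hr₀
      · intro r' hr' hi
        rcases le_or_gt r' t₀ with hle | hlt
        · exact absurd (Nat.le_findGreatest (P := fun r => IsInv T r (pre a r)) hle hi) (by omega)
        · exact hno _ hlt.le hi
    have hi := hmax (r + 1 + T (r + 1) + 1) (by omega)
    rw [isInv_succ_iff] at hi
    exact hi (Or.inr ⟨hmax _ (by omega), Or.inl ⟨r, by omega, hr, fun r' _ => hmax r', by omega⟩⟩)
  · push Not at h
    have hi := h (T 1 + 1)
    rw [isInv_succ_iff] at hi
    exact hi (Or.inr ⟨h _, Or.inr ⟨fun r _ => h r, by omega⟩⟩)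

/-- An investment history followed by `(I, I)` is again an investment history, so the first one
beyond `t₀` starts a phase that never ends. -/
lemma eventually_bothI {t₀ : ℕ} (h : ∀ t ≥ t₀, IsInv T t (pre a t) → a t = bothI) :
    ∃ n, ∀ t ≥ n, a t = bothI := by
  obtain ⟨n, hn, hi⟩ := exists_isInv_ge (T := T) (a := a) t₀
  have key : ∀ k, IsInv T (n + k) (pre a (n + k)) := by
    intro k
    induction k with
    | zero => exact hi
    | succ k ih => exact (isInv_succ_of_isInv ih).2 (h _ (by omega) ih)
  refine ⟨n, fun t ht => ?_⟩
  obtain ⟨k, rfl⟩ := Nat.exists_eq_add_of_le ht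
  exact h _ (by omega) (key k)

end Scheme

/-! ### Product weights of signal strings -/

section Weights

variable {X : Type*}

/-- The product weight of a string of signals. -/
def weight (g : X → ℝ) {n : ℕ} (x : Fin n → X) : ℝ := ∏ k, g (x k)

lemma weight_nonneg {g : X → ℝ} (hg : ∀ x, 0 ≤ g x) {n : ℕ} (x : Fin n → X) : 0 ≤ weight g x :=
  Finset.prod_nonneg fun _ _ => hg _

lemma weight_snoc (g : X → ℝ) {n : ℕ} (x : Fin n → X) (y : X) :
    weight g (Fin.snoc (α := fun _ => X) x y) = weight g x * g y := by
  simp [weight, Fin.prod_univ_castSucc]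

lemma sum_snoc [Fintype X] {n : ℕ} (F : (Fin (n + 1) → X) → ℝ) :
    ∑ z, F z = ∑ x : Fin n → X, ∑ y, F (Fin.snoc (α := fun _ => X) x y) := by
  rw [← (Fin.snocEquiv (fun _ : Fin (n + 1) => X)).sum_comp, Fintype.sum_prod_type_right]
  rfl

lemma sum_weight [Fintype X] {g : X → ℝ} (n : ℕ) :
    ∑ x : Fin n → X, weight g x = (∑ y, g y) ^ n := by
  simp only [weight]
  rw [Finset.sum_pow']
  simp

lemma weight_le_pow_mul_weight {g h : X → ℝ} {K : ℝ} (hg : ∀ x, 0 ≤ g x)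
    (hgh : ∀ x, g x ≤ K * h x) {n : ℕ} (x : Fin n → X) : weight g x ≤ K ^ n * weight h x := by
  simp only [weight]
  calc ∏ k, g (x k) ≤ ∏ k, (K * h (x k)) :=
        Finset.prod_le_prod (fun _ _ => hg _) (fun _ _ => hgh _)
    _ = K ^ n * ∏ k, h (x k) := by rw [Finset.prod_mul_distrib]; simp

end Weights

/-! ### Consistency with pure strategies -/

section Consistent

variable {X : Type*} {i : Player} {s : PureStrategy X}

lemma consistentPure_pre_iff {t : ℕ} {a : ℕ → Profile} {x : ℕ → X} :
    ConsistentPure i s (pre a t) (pre x (t + 1)) ↔ ∀ k < t, s (node a x k) = a k i :=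
  ⟨fun h k hk => h ⟨k, hk⟩, fun h k => h k k.isLt⟩

lemma consistentPure_succ_iff {t : ℕ} {a : ℕ → Profile} {z : Fin (t + 2) → X} :
    ConsistentPure i s (pre a (t + 1)) z ↔
      ConsistentPure i s (pre a t) (Fin.init z) ∧ s ⟨t, pre a t, Fin.init z⟩ = a t i := by
  constructor
  · intro h
    exact ⟨fun k => h k.castSucc, h (Fin.last t)⟩
  · rintro ⟨h1, h2⟩ k
    refine Fin.lastCases ?_ (fun k => ?_) k
    · exact h2
    · exact h1 k

lemma consistentPure_zero {a : ActHist 0} {x : Fin 1 → X} : ConsistentPure i s a x :=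
  fun k => k.elim0

lemma measurableSet_apply_eq (h : PrivHist X) (b : Act) :
    MeasurableSet {s : PureStrategy X | s h = b} :=
  (measurable_pi_apply (X := fun _ : PrivHist X => Act) h) (measurableSet_singleton b)

lemma measurableSet_consistentPure {t : ℕ} (a : ActHist t) (x : Fin (t + 1) → X) :
    MeasurableSet {s : PureStrategy X | ConsistentPure i s a x} := by
  simp only [ConsistentPure, Set.ofPred_forall]
  exact MeasurableSet.iInter fun k => measurableSet_apply_eq _ _

lemma isOpen_consistentPure {t : ℕ} (a : ActHist t) (x : Fin (t + 1) → X) :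
    IsOpen {s : PureStrategy X | ConsistentPure i s a x} := by
  simp only [ConsistentPure, Set.ofPred_forall]
  exact isOpen_iInter_of_finite fun k =>
    (isOpen_discrete {a k i}).preimage
      (continuous_apply (A := fun _ : PrivHist X => Act) (pastHist a x k))

lemma isClosed_pureCoolOff (T : ℕ → ℕ) : IsClosed (pureCoolOff X T) := by
  simp only [pureCoolOff, Set.ofPred_forall]
  refine isClosed_iInter fun t => isClosed_iInter fun a => isClosed_iInter fun x =>
    isClosed_iInter fun _ => ?_
  exact (isClosed_discrete {Act.N}).preimage
    (continuous_apply (A := fun _ : PrivHist X => Act) ⟨t, a, x⟩)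

end Consistent

/-! ### The likelihood of one player's part of an action history -/

section Reach

variable {X : Type*} [Fintype X]

/-- The weight, with signals weighted by `g`, with which player `i` acts according to the action
history `a`. -/
noncomputable def reach (g : X → ℝ) (i : Player) (μ : Measure (PureStrategy X)) {t : ℕ}
    (a : ActHist t) : ℝ :=
  ∑ x : Fin (t + 1) → X, weight g x * μ.real {s | ConsistentPure i s a x}

/-- The weight, with signals weighted by `g`, with which player `i` acts according to the action
history `a` and then chooses `b`. -/
noncomputable def reachAct (g : X → ℝ) (i : Player) (μ : Measure (PureStrategy X)) {t : ℕ}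
    (a : ActHist t) (b : Act) : ℝ :=
  ∑ x : Fin (t + 1) → X, weight g x * μ.real {s | ConsistentPure i s a x ∧ s ⟨t, a, x⟩ = b}

variable {g h : X → ℝ} {i : Player} {μ : Measure (PureStrategy X)}

lemma reach_nonneg (hg : ∀ x, 0 ≤ g x) {t : ℕ} (a : ActHist t) : 0 ≤ reach g i μ a :=
  Finset.sum_nonneg fun _ _ => mul_nonneg (weight_nonneg hg _) measureReal_nonneg

lemma reachAct_nonneg (hg : ∀ x, 0 ≤ g x) {t : ℕ} (a : ActHist t) (b : Act) :
    0 ≤ reachAct g i μ a b :=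
  Finset.sum_nonneg fun _ _ => mul_nonneg (weight_nonneg hg _) measureReal_nonneg

lemma reachAct_le_reach [IsFiniteMeasure μ] (hg : ∀ x, 0 ≤ g x) {t : ℕ} (a : ActHist t) (b : Act) :
    reachAct g i μ a b ≤ reach g i μ a :=
  Finset.sum_le_sum fun _ _ => mul_le_mul_of_nonneg_left
    (measureReal_mono (fun _ hs => hs.1)) (weight_nonneg hg _)

lemma reachAct_I_add_reachAct_N [IsFiniteMeasure μ] {t : ℕ} (a : ActHist t) :
    reachAct g i μ a Act.I + reachAct g i μ a Act.N = reach g i μ a := by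
  simp only [reachAct, reach, ← Finset.sum_add_distrib, ← mul_add]
  refine Finset.sum_congr rfl fun x _ => ?_
  congr 1
  rw [← measureReal_inter_add_sdiff (s := {s | ConsistentPure i s a x})
    (measurableSet_apply_eq ⟨t, a, x⟩ Act.I)]
  congr 2
  ext s
  simp [eq_N_iff]

/-- `reach` already sums over the signal seen before acting, so one more period brings in one fresh
signal of total weight `∑ g`. This is `1` for a probability law and less than `1` for the
Bhattacharyya weight of two distinct laws. -/
lemma reach_succ (a : ℕ → Profile) (t : ℕ) :
    reach g i μ (pre a (t + 1)) = (∑ y, g y) * reachAct g i μ (pre a t) (a t i) := by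
  simp only [reach, reachAct, sum_snoc (n := t + 1), weight_snoc, consistentPure_succ_iff,
    Fin.init_snoc, Finset.mul_sum]
  refine Finset.sum_congr rfl fun x _ => ?_
  rw [Finset.sum_mul]
  exact Finset.sum_congr rfl fun y _ => by ring

lemma reach_succ_le [IsFiniteMeasure μ] (hg : ∀ x, 0 ≤ g x) (a : ℕ → Profile) (t : ℕ) :
    reach g i μ (pre a (t + 1)) ≤ (∑ y, g y) * reach g i μ (pre a t) := by
  rw [reach_succ]
  exact mul_le_mul_of_nonneg_left (reachAct_le_reach hg _ _) (Finset.sum_nonneg fun y _ => hg y)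

/-- The strategy does not depend on the state, so only the weights of the `t + 1` signals are
compared. -/
lemma reach_le_pow_mul_reach {K : ℝ} (hg : ∀ x, 0 ≤ g x) (hgh : ∀ x, g x ≤ K * h x) {t : ℕ}
    (a : ActHist t) : reach g i μ a ≤ K ^ (t + 1) * reach h i μ a := by
  simp only [reach, Finset.mul_sum, ← mul_assoc]
  exact Finset.sum_le_sum fun x _ => mul_le_mul_of_nonneg_right
    (weight_le_pow_mul_weight hg hgh x) measureReal_nonneg

lemma reachAct_N_of_coolOff {T : ℕ → ℕ} (hμ : ∀ᵐ s ∂μ, s ∈ pureCoolOff X T)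
    {t : ℕ} {a : ActHist t} (ha : ¬ IsInv T t a ∨ CoolOffViolated T a) :
    reachAct g i μ a Act.N = reach g i μ a := by
  simp only [reach, reachAct]
  refine Finset.sum_congr rfl fun x _ => ?_
  congr 1
  refine measureReal_congr ?_
  filter_upwards [hμ] with s hs
  exact propext ⟨fun h => h.1, fun h => ⟨h, hs t a x ha⟩⟩

end Reach

/-! ### The strategy sets in terms of probabilities -/

section Membership

variable {X : Type*}

lemma support_subset_iff {Y : Type*} [TopologicalSpace Y] [MeasurableSpace Y]
    [HereditarilyLindelofSpace Y] {μ : Measure Y} {C : Set Y} (hC : IsClosed C) :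
    μ.support ⊆ C ↔ ∀ᵐ y ∂μ, y ∈ C :=
  ⟨fun h => Filter.mem_of_superset Measure.support_mem_ae h,
    fun h => Measure.support_subset_of_isClosed hC h⟩

lemma mem_mixedCoolOff_iff [Finite X] {T : ℕ → ℕ} {σ : MixedStrategy X} :
    σ ∈ mixedCoolOff X T ↔ ∀ᵐ s ∂(σ : Measure (PureStrategy X)), s ∈ pureCoolOff X T :=
  support_subset_iff (isClosed_pureCoolOff T)

/-- The conditional probabilities telescope. An undefined factor is `0` by division by zero, and
then the right side vanishes too. -/
lemma prod_behavior (i : Player) (σ : MixedStrategy X) (a : ℕ → Profile) (t : ℕ)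
    (x : ℕ → X) :
    ∏ k : Fin t, behavior i σ (node a x k) (a k i) =
      (σ : Measure (PureStrategy X)).real {s | ConsistentPure i s (pre a t) (pre x (t + 1))} := by
  induction t with
  | zero => simp [consistentPure_zero]
  | succ t ih =>
    rw [Fin.prod_univ_castSucc]
    simp only [Fin.val_castSucc, Fin.val_last, ih]
    have h2 : {s | ConsistentPure i s (pre a (t + 1)) (pre x (t + 1 + 1))} =
        {s | ConsistentPure i s (pre a t) (pre x (t + 1)) ∧ s (node a x t) = a t i} :=
      Set.ext fun s => consistentPure_succ_iff
    rw [h2]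
    simp only [behavior, node]
    by_cases h0 : (σ : Measure (PureStrategy X)).real
        {s | ConsistentPure i s (pre a t) (pre x (t + 1))} = 0
    · rw [h0, zero_mul, eq_comm]
      exact measureReal_mono_null (fun s hs => hs.1) h0
    · field_simp

lemma prod_behavior_pastHist [Nonempty X] (i : Player) (σ : MixedStrategy X) {t : ℕ}
    (a : ActHist t) (x : Fin (t + 1) → X) :
    ∏ k : Fin t, behavior i σ (pastHist a x k) (a k i) =
      (σ : Measure (PureStrategy X)).real {s | ConsistentPure i s a x} := by
  have : Nonempty Act := ⟨Act.I⟩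
  obtain ⟨a, rfl⟩ := exists_pre_eq a
  obtain ⟨x, rfl⟩ := exists_pre_eq x
  exact prod_behavior i σ a t x

variable [Fintype X]

lemma investProb_eq [Nonempty X] (p : PMF X) (i : Player) (σ : MixedStrategy X) {t : ℕ}
    (a : ActHist t) : investProb p i σ a =
      reachAct (fun x => (p x).toReal) i σ a Act.I / reach (fun x => (p x).toReal) i σ a := by
  simp only [investProb, prod_behavior_pastHist]
  congr 1
  refine Finset.sum_congr rfl fun x _ => ?_
  congr 1
  simp only [behavior]
  by_cases h0 : (σ : Measure (PureStrategy X)).real {s | ConsistentPure i s a x} = 0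
  · rw [h0, zero_mul, eq_comm]
    exact measureReal_mono_null (fun s hs => hs.1) h0
  · field_simp

/-- The pure strategies consistent with a private history form an open set, so this set meets the
support exactly when it has positive measure; full support of the signals does the rest. -/
lemma consistentAct_iff {p : PMF X} (hp : ∀ x, 0 < p x) {i : Player} {σ : MixedStrategy X}
    {t : ℕ} {a : ActHist t} :
    ConsistentAct p i σ a ↔ 0 < reach (fun x => (p x).toReal) i σ a := by
  have hp' : ∀ x, 0 < (p x).toReal := fun x => ENNReal.toReal_pos (hp x).ne' (p.apply_ne_top x)
  have hw : ∀ {n : ℕ} (x : Fin n → X), 0 < weight (fun x => (p x).toReal) x :=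
    fun x => Finset.prod_pos fun _ _ => hp' _
  constructor
  · rintro ⟨x, -, s, hs, hc⟩
    refine Finset.sum_pos' (fun x _ => mul_nonneg (hw x).le measureReal_nonneg)
      ⟨x, Finset.mem_univ _, mul_pos (hw x) ?_⟩
    have := (Measure.mem_support_iff_forall s).1 hs _ ((isOpen_consistentPure a x).mem_nhds hc)
    exact ENNReal.toReal_pos this.ne' (measure_ne_top _ _)
  · intro h
    obtain ⟨x, -, hx⟩ := Finset.exists_lt_of_sum_lt
      (f := fun _ => (0 : ℝ)) (by simpa [reach] using h)
    refine ⟨x, hw x, ?_⟩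
    have h1 := (pos_iff_pos_of_mul_pos hx).1 (hw x)
    have h2 : 0 < (σ : Measure (PureStrategy X)) {s | ConsistentPure i s a x} :=
      (ENNReal.toReal_pos_iff.1 h1).1
    obtain ⟨s, hs1, hs2⟩ := Measure.nonempty_inter_support_of_pos h2
    exact ⟨s, hs2, hs1⟩

/-- A form without topology and without division: at inconsistent histories both sides of the
inequality vanish, so the consistency proviso can be dropped. -/
lemma mem_coolOffStrategies_iff {f : State → PMF X} (hf : ∀ θ x, 0 < f θ x) {T : ℕ → ℕ} {ε : ℝ}
    {i : Player} {σ : MixedStrategy X} : σ ∈ coolOffStrategies f T ε i ↔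
      (∀ᵐ s ∂(σ : Measure (PureStrategy X)), s ∈ pureCoolOff X T) ∧
      ∀ (t : ℕ) (a : ActHist t), IsInv T t a → ¬ CoolOffViolated T a →
        (1 - ε) * reach (fun x => (f State.H x).toReal) i σ a ≤
          reachAct (fun x => (f State.H x).toReal) i σ a Act.I := by
  have : Nonempty X := (f State.H).support_nonempty.to_type
  rw [coolOffStrategies, Set.mem_ofPred_eq, mem_mixedCoolOff_iff]
  refine and_congr_right fun _ => forall_congr' fun t => forall_congr' fun a =>
    forall_congr' fun _ => forall_congr' fun _ => ?_
  rw [consistentAct_iff (hf State.H), investProb_eq]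
  constructor
  · intro h
    rcases (reach_nonneg (g := fun x => (f State.H x).toReal) (i := i)
      (μ := (σ : Measure (PureStrategy X))) (fun x => ENNReal.toReal_nonneg) a).eq_or_lt
      with h0 | h0
    · rw [← h0, mul_zero]
      exact reachAct_nonneg (fun x => ENNReal.toReal_nonneg) a _
    · exact (le_div_iff₀ h0).1 (h h0)
  · intro h h0
    exact (le_div_iff₀ h0).2 h

end Membership

/-! ### Investing when confident of the high state satisfies the constraint -/

section Slack

variable {X : Type*}

lemma weight_sqrt_sq {g h : X → ℝ} (hg : ∀ x, 0 ≤ g x) (hh : ∀ x, 0 ≤ h x) {n : ℕ}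
    (x : Fin n → X) :
    weight (fun y => √(g y * h y)) x ^ 2 = weight g x * weight h x := by
  simp only [weight, ← Finset.prod_pow, ← Finset.prod_mul_distrib]
  exact Finset.prod_congr rfl fun k _ => Real.sq_sqrt (mul_nonneg (hg _) (hh _))

/-- Where the likelihood ratio is bounded, a weight is controlled by the geometric mean of both
weights, whose total mass decays geometrically when the laws differ. -/
lemma weight_le_mul_weight_sqrt {g h : X → ℝ} (hg : ∀ x, 0 ≤ g x) (hh : ∀ x, 0 ≤ h x) {n : ℕ}
    {x : Fin n → X} {Y : ℝ} (hY : 1 ≤ Y) (hx : weight g x ≤ Y * weight h x) :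
    weight g x ≤ Y * weight (fun y => √(g y * h y)) x := by
  have hw := weight_nonneg hg x
  have hwh := weight_nonneg hh x
  have hws := weight_nonneg (g := fun y => √(g y * h y)) (fun y => Real.sqrt_nonneg _) x
  refine le_of_sq_le_sq ?_ (by positivity)
  rw [mul_pow, weight_sqrt_sq hg hh]
  calc weight g x ^ 2 = weight g x * weight g x := sq _
    _ ≤ weight g x * (Y * weight h x) := mul_le_mul_of_nonneg_left hx hw
    _ = Y * (weight g x * weight h x) := by ring
    _ ≤ Y ^ 2 * (weight g x * weight h x) := by
        refine mul_le_mul_of_nonneg_right ?_ (by positivity)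
        nlinarith

variable [Fintype X]

/-- The probability of the state (with prior `p`), of the own signals and of the actions of the
opponent `j` along the private history `h`. -/
noncomputable def stateWeight (p : ℝ) (g : X → ℝ) (j : Player) (ν : Measure (PureStrategy X))
    (h : PrivHist X) : ℝ :=
  p * weight g h.2.2 * reach g j ν h.2.1

/-- The reach is constant through the cool-off phase, where `N` is certain, and loses at most a
factor `1 - ε` in each period of joint investment. -/
lemma pow_mul_reach_le {g : X → ℝ} (hg1 : ∑ x, g x = 1) {l : Player}
    {μ : Measure (PureStrategy X)} {T : ℕ → ℕ} {ε : ℝ} (hε1 : ε ≤ 1)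
    (hμ : ∀ᵐ s ∂μ, s ∈ pureCoolOff X T) {a : ℕ → Profile} {t q p : ℕ} (hqp : q ≤ p) (hpt : p ≤ t)
    (hviol : ¬ CoolOffViolated T (pre a t))
    (hcool : ∀ k, q ≤ k → k < p → ¬ IsInv T k (pre a k))
    (hinv : ∀ k, p ≤ k → k < t → IsInv T k (pre a k) ∧ a k = bothI)
    (hcons : ∀ k < t, IsInv T k (pre a k) →
      (1 - ε) * reach g l μ (pre a k) ≤ reachAct g l μ (pre a k) Act.I) :
    (1 - ε) ^ (t - p) * reach g l μ (pre a q) ≤ reach g l μ (pre a t) := by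
  have h1 : ∀ k, q + k ≤ p → reach g l μ (pre a (q + k)) = reach g l μ (pre a q) := by
    intro k
    induction k with
    | zero => intro _; rfl
    | succ k ih =>
      intro hk
      have hc := hcool (q + k) (by omega) (by omega)
      rw [← add_assoc, reach_succ, hg1, one_mul,
        eq_N_of_not_violated (show q + k < t by omega) hviol hc,
        reachAct_N_of_coolOff hμ (Or.inl hc), ih (by omega)]
  have h2 : ∀ k, p + k ≤ t →
      (1 - ε) ^ k * reach g l μ (pre a q) ≤ reach g l μ (pre a (p + k)) := by
    intro k
    induction k with
    | zero =>
      intro _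
      have := h1 (p - q) (by omega)
      rw [show q + (p - q) = p by omega] at this
      simp [this]
    | succ k ih =>
      intro hk
      obtain ⟨hi, hb⟩ := hinv (p + k) (by omega) (by omega)
      rw [← add_assoc, reach_succ, hg1, one_mul, hb]
      calc (1 - ε) ^ (k + 1) * reach g l μ (pre a q)
          = (1 - ε) * ((1 - ε) ^ k * reach g l μ (pre a q)) := by ring
        _ ≤ (1 - ε) * reach g l μ (pre a (p + k)) :=
            mul_le_mul_of_nonneg_left (ih (by omega)) (by linarith)
        _ ≤ _ := hcons _ (by omega) hi
  have := h2 (t - p) (by omega)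
  rwa [show p + (t - p) = t by omega] at this

/-- For the Bhattacharyya weight this is the decay due to the signals received after time `q`. -/
lemma reach_le_pow_sub {g : X → ℝ} (hg : ∀ x, 0 ≤ g x) {l : Player}
    {μ : Measure (PureStrategy X)} [IsFiniteMeasure μ] (a : ℕ → Profile) {t q : ℕ} (hqt : q ≤ t) :
    reach g l μ (pre a t) ≤ (∑ y, g y) ^ (t - q) * reach g l μ (pre a q) := by
  obtain ⟨k, rfl⟩ := Nat.exists_eq_add_of_le hqt
  rw [show q + k - q = k by omega]
  clear hqt
  induction k with
  | zero => simp
  | succ k ih =>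
    refine (reach_succ_le hg a (q + k)).trans ?_
    rw [pow_succ', mul_assoc]
    exact mul_le_mul_of_nonneg_left ih (Finset.sum_nonneg fun y _ => hg y)

/-- If both players have respected the constraint on all earlier investment histories, then a
player who invests whenever confident of the high state respects it as well. -/
lemma constraint_of_invest_high {gH gL : X → ℝ} (hgH : ∀ x, 0 ≤ gH x) (hgL : ∀ x, 0 ≤ gL x)
    (hH1 : ∑ x, gH x = 1) (hL1 : ∑ x, gL x = 1) {pH pL κ C K ε : ℝ} (hpH : 0 < pH) (hpL : 0 < pL)
    (hκ : 0 < κ) (hC1 : 1 ≤ C) (hC : pL ≤ C * (κ * pH)) (hK1 : 1 ≤ K)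
    (hK : ∀ x, gL x ≤ K * gH x) (hε : ε < 1)
    (hr : ∑ x, √(gH x * gL x) ≤ (1 - ε) ^ 2) {T : ℕ → ℕ}
    (hT : ∀ n, C * K ^ (2 * (n + 1)) * (∑ x, √(gH x * gL x)) ^ T n ≤ ε)
    (hr1 : ∑ x, √(gH x * gL x) ≤ 1)
    {i j : Player} {μ ν : Measure (PureStrategy X)} [IsFiniteMeasure μ] [IsFiniteMeasure ν]
    (hμ : ∀ᵐ s ∂μ, s ∈ pureCoolOff X T) (hν : ∀ᵐ s ∂ν, s ∈ pureCoolOff X T)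
    {a : ℕ → Profile} {t : ℕ} (hinv : IsInv T t (pre a t))
    (hviol : ¬ CoolOffViolated T (pre a t))
    (hconsμ : ∀ k < t, IsInv T k (pre a k) →
      (1 - ε) * reach gH i μ (pre a k) ≤ reachAct gH i μ (pre a k) Act.I)
    (hconsν : ∀ k < t, IsInv T k (pre a k) →
      (1 - ε) * reach gH j ν (pre a k) ≤ reachAct gH j ν (pre a k) Act.I)
    (hI : ∀ x : Fin (t + 1) → X,
      stateWeight pL gL j ν ⟨t, pre a t, x⟩ ≤ κ * stateWeight pH gH j ν ⟨t, pre a t, x⟩ →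
      ∀ᵐ s ∂μ, s ⟨t, pre a t, x⟩ = Act.I) :
    (1 - ε) * reach gH i μ (pre a t) ≤ reachAct gH i μ (pre a t) Act.I := by
  obtain ⟨q, p, hqp, hpt, hcool, hpi⟩ := exists_phase hinv
  set g : X → ℝ := fun x => √(gH x * gL x) with hg
  set r := ∑ x, g x with hr_def
  have hg0 : ∀ x, 0 ≤ g x := fun x => Real.sqrt_nonneg _
  have hr0 : 0 ≤ r := Finset.sum_nonneg fun x _ => hg0 x
  have hK0 : 0 < K := by linarith
  have hgK : ∀ x, g x ≤ K * gH x := by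
    intro x
    refine Real.sqrt_le_iff.2 ⟨mul_nonneg hK0.le (hgH x), ?_⟩
    calc gH x * gL x ≤ gH x * (K * gH x) := mul_le_mul_of_nonneg_left (hK x) (hgH x)
      _ = K * gH x ^ 2 := by ring
      _ ≤ K ^ 2 * gH x ^ 2 := mul_le_mul_of_nonneg_right (by nlinarith) (sq_nonneg _)
      _ = _ := by ring
  have hqp' : q ≤ p := by omega
  set n := t - p with hn
  set b := (1 - ε) ^ n with hb
  have hb0 : 0 < b := pow_pos (by linarith) _
  have hbμ : b * reach gH i μ (pre a q) ≤ reach gH i μ (pre a t) :=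
    pow_mul_reach_le hH1 hε.le hμ hqp' hpt hviol hcool hpi hconsμ
  have hbν : b * reach gH j ν (pre a q) ≤ reach gH j ν (pre a t) :=
    pow_mul_reach_le hH1 hε.le hν hqp' hpt hviol hcool hpi hconsν
  have hRH0 : ∀ (l : Player) (m : Measure (PureStrategy X)) (k : ℕ), 0 ≤ reach gH l m (pre a k) :=
    fun l m k => reach_nonneg hgH _
  -- The opponent's actions can favour `L` only by a factor `K ^ (q + 1) / b`: the signals up to
  -- time `q` account for the power of `K`, and after `q` the reach in `L` cannot grow while the
  -- reach in `H` keeps at least a share `b`.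
  have hLH : b * reach gL j ν (pre a t) ≤ K ^ (q + 1) * reach gH j ν (pre a t) := by
    have h1 := reach_le_pow_sub hgL (l := j) (μ := ν) a (show q ≤ t by omega)
    rw [hL1, one_pow, one_mul] at h1
    have h2 := reach_le_pow_mul_reach (i := j) (μ := ν) hgL hK (pre a q)
    calc b * reach gL j ν (pre a t) ≤ b * (K ^ (q + 1) * reach gH j ν (pre a q)) :=
          mul_le_mul_of_nonneg_left (h1.trans h2) hb0.le
      _ = K ^ (q + 1) * (b * reach gH j ν (pre a q)) := by ring
      _ ≤ _ := mul_le_mul_of_nonneg_left hbν (by positivity)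
  have hε0 : 0 ≤ ε := le_trans (by positivity) (hT 0)
  have hb1 : b ≤ 1 := pow_le_one₀ (by linarith) (by linarith)
  set Y := C * K ^ (q + 1) / b with hY
  have hY1 : 1 ≤ Y := by
    rw [hY, one_le_div hb0]
    exact hb1.trans (one_le_mul_of_one_le_of_one_le hC1 (one_le_pow₀ hK1))
  -- Without confidence, the own signals cannot favour `H` by more than `Y`: the prior and `κ` are
  -- absorbed by `C`, the opponent's actions by `hLH`.
  have hlow : ∀ x : Fin (t + 1) → X,
      ¬ stateWeight pL gL j ν ⟨t, pre a t, x⟩ ≤ κ * stateWeight pH gH j ν ⟨t, pre a t, x⟩ →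
      weight gH x ≤ Y * weight gL x := by
    intro x hx
    simp only [stateWeight, not_le] at hx
    have hwL := weight_nonneg hgL x
    have hwH := weight_nonneg hgH x
    have hkey : κ * (pH * weight gH x * reach gH j ν (pre a t)) <
        (κ * pH) * (Y * weight gL x) * reach gH j ν (pre a t) := by
      calc _ < pL * weight gL x * reach gL j ν (pre a t) := hx
        _ ≤ pL * weight gL x * (K ^ (q + 1) * reach gH j ν (pre a t) / b) := by
            refine mul_le_mul_of_nonneg_left ?_ (by positivity)
            rw [le_div_iff₀ hb0, mul_comm]; exact hLH
        _ ≤ (C * (κ * pH)) * weight gL x * (K ^ (q + 1) * reach gH j ν (pre a t) / b) := by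
            have := hRH0 j ν t
            refine mul_le_mul_of_nonneg_right ?_ (by positivity)
            exact mul_le_mul_of_nonneg_right hC hwL
        _ = _ := by rw [hY]; field_simp
    by_contra! hlt
    refine absurd hkey (not_lt.2 ?_)
    calc (κ * pH) * (Y * weight gL x) * reach gH j ν (pre a t)
        ≤ (κ * pH) * weight gH x * reach gH j ν (pre a t) :=
          mul_le_mul_of_nonneg_right
            (mul_le_mul_of_nonneg_left hlt.le (by positivity)) (hRH0 j ν t)
      _ = _ := by ring
  -- Only signals without confidence contribute to `N`, and there the `H`-weight is at most `Y`
  -- times the geometric mean weight.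
  have hN : reachAct gH i μ (pre a t) Act.N ≤ Y * reach g i μ (pre a t) := by
    simp only [reachAct, reach, Finset.mul_sum]
    refine Finset.sum_le_sum fun x _ => ?_
    by_cases hx : stateWeight pL gL j ν ⟨t, pre a t, x⟩ ≤ κ * stateWeight pH gH j ν ⟨t, pre a t, x⟩
    · have h0 : μ.real {s | ConsistentPure i s (pre a t) x ∧ s ⟨t, pre a t, x⟩ = Act.N} = 0 := by
        rw [measureReal_eq_zero_iff]
        refine measure_mono_null (fun s hs => ?_) (ae_iff.1 (hI x hx))
        simpa [eq_N_iff] using hs.2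
      rw [h0, mul_zero]
      have := weight_nonneg hg0 x
      positivity
    · rw [← mul_assoc]
      have := weight_nonneg hg0 x
      exact mul_le_mul (weight_le_mul_weight_sqrt hgH hgL hY1 (hlow x hx))
        (measureReal_mono fun s hs => hs.1) measureReal_nonneg (by positivity)
  have hmain : Y * reach g i μ (pre a t) ≤ ε * reach gH i μ (pre a t) := by
    have h1 := reach_le_pow_sub hg0 (l := i) (μ := μ) a (show q ≤ t by omega)
    have h2 := reach_le_pow_mul_reach (i := i) (μ := μ) hg0 hgK (pre a q)
    -- The cool-off phase supplies `r ^ T`. Each of the `n` investment periods supplies `r ≤ (1 - ε)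
    -- ^ 2`: one factor `b` cancels the `1 / b` in `Y`, the other pays for the decay of the own
    -- reach in state `H`.
    have hrp : r ^ (t - q) ≤ r ^ T (max q 1) * (b * b) := by
      rw [show t - q = (p - q) + n by omega, pow_add]
      refine mul_le_mul (pow_le_pow_of_le_one hr0 hr1 (by omega)) ?_ (by positivity) (by positivity)
      calc r ^ n ≤ ((1 - ε) ^ 2) ^ n := pow_le_pow_left₀ hr0 hr n
        _ = b * b := by rw [hb, ← pow_mul, ← pow_add, two_mul]
    have hYb : Y * b = C * K ^ (q + 1) := by rw [hY]; field_simp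
    calc Y * reach g i μ (pre a t)
        ≤ Y * (r ^ (t - q) * (K ^ (q + 1) * reach gH i μ (pre a q))) := by
          gcongr
          exact h1.trans (mul_le_mul_of_nonneg_left h2 (by positivity))
      _ ≤ Y * ((r ^ T (max q 1) * (b * b)) * (K ^ (q + 1) * reach gH i μ (pre a q))) := by
          have := hRH0 i μ q
          gcongr
      _ = (Y * b) * K ^ (q + 1) * r ^ T (max q 1) * (b * reach gH i μ (pre a q)) := by ring
      _ ≤ (Y * b) * K ^ (q + 1) * r ^ T (max q 1) * reach gH i μ (pre a t) := by
          gcongr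
      _ = C * K ^ (2 * (q + 1)) * r ^ T (max q 1) * reach gH i μ (pre a t) := by
          rw [hYb]; ring
      _ ≤ ε * reach gH i μ (pre a t) := by
          -- Since `K ≥ 1`, raising the exponent from `q` to `max q 1` only weakens the bound; this
          -- matters for the initial phase.
          refine mul_le_mul_of_nonneg_right (le_trans ?_ (hT (max q 1))) (hRH0 i μ t)
          gcongr
          exact le_max_left _ _
  have := reachAct_I_add_reachAct_N (g := gH) (i := i) (μ := μ) (pre a t)
  linarith

end Slack

/-! ### Deviations that switch strategy, and their feasibility -/

section Switch

variable {X : Type*}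

/-- The private history at which a player acted in period `k + 1` on the way to `h`, where the
player acts at `h` itself if `k` is the length of `h`. -/
def trunc (h : PrivHist X) (k : ℕ) (hk : k ≤ h.1) : PrivHist X :=
  ⟨k, Fin.take k hk h.2.1, Fin.take (k + 1) (Nat.succ_le_succ hk) h.2.2⟩

open Classical in
/-- Follow `s` until the first private history satisfying `C` at which `s` chooses `b`; from there
on, follow `r`. -/
noncomputable def switch (C : PrivHist X → Prop) (b : Act) (r s : PureStrategy X) :
    PureStrategy X :=
  fun h => if ∃ (k : ℕ) (hk : k ≤ h.1), C (trunc h k hk) ∧ s (trunc h k hk) = b then r h else s h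

variable {C : PrivHist X → Prop} {b : Act} {r s : PureStrategy X}

lemma switch_node_of_exists {a : ℕ → Profile} {x : ℕ → X} {t : ℕ}
    (h : ∃ k ≤ t, C (node a x k) ∧ s (node a x k) = b) :
    switch C b r s (node a x t) = r (node a x t) :=
  if_pos (by obtain ⟨k, hk, h⟩ := h; exact ⟨k, hk, h⟩)

lemma switch_node_of_forall {a : ℕ → Profile} {x : ℕ → X} {t : ℕ}
    (h : ∀ k ≤ t, ¬ (C (node a x k) ∧ s (node a x k) = b)) :
    switch C b r s (node a x t) = s (node a x t) :=
  if_neg (by rintro ⟨k, hk, h'⟩; exact h k hk h')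

lemma switch_of_eq {h : PrivHist X} (hC : C h) (hs : s h = b) : switch C b r s h = r h :=
  if_pos ⟨h.1, le_rfl, hC, hs⟩

lemma switch_eq_or (h : PrivHist X) : switch C b r s h = r h ∨ switch C b r s h = s h := by
  unfold switch; split_ifs <;> simp

lemma measurable_switch (C : PrivHist X → Prop) (b : Act) (r : PureStrategy X) :
    Measurable (switch C b r) := by
  refine measurable_pi_iff.2 fun h => Measurable.ite ?_ measurable_const (measurable_pi_apply h)
  simp only [Set.ofPred_exists]
  refine MeasurableSet.iUnion fun k => MeasurableSet.iUnion fun hk => ?_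
  exact (MeasurableSet.const _).inter (measurableSet_apply_eq _ _)

lemma switch_mem_pureCoolOff {T : ℕ → ℕ} (hr : r ∈ pureCoolOff X T) (hs : s ∈ pureCoolOff X T) :
    switch C b r s ∈ pureCoolOff X T := by
  intro t a x h
  rcases switch_eq_or (C := C) (b := b) (r := r) (s := s) ⟨t, a, x⟩ with h' | h'
  · rw [h']; exact hr t a x h
  · rw [h']; exact hs t a x h

open Classical in
/-- Invest at every investment history at which nobody has invested during a cool-off phase. -/
noncomputable def alwaysInvest (X : Type*) (T : ℕ → ℕ) : PureStrategy X :=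
  fun h => if IsInv T h.1 h.2.1 ∧ ¬ CoolOffViolated T h.2.1 then Act.I else Act.N

lemma alwaysInvest_mem {T : ℕ → ℕ} : alwaysInvest X T ∈ pureCoolOff X T := by
  intro t a x h
  exact if_neg (by tauto)

/-- The mixed strategy that plays according to `switch C b r`. -/
noncomputable def mixedSwitch (C : PrivHist X → Prop) (b : Act) (r : PureStrategy X)
    (σ : MixedStrategy X) : MixedStrategy X :=
  σ.map (measurable_switch C b r).aemeasurable

lemma coe_mixedSwitch (σ : MixedStrategy X) :
    (mixedSwitch C b r σ : Measure (PureStrategy X)) =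
      (σ : Measure (PureStrategy X)).map (switch C b r) := rfl

lemma measurableSet_pureCoolOff [Finite X] (T : ℕ → ℕ) : MeasurableSet (pureCoolOff X T) := by
  have : pureCoolOff X T = ⋂ h : PrivHist X, {s | ¬ IsInv T h.1 h.2.1 ∨ CoolOffViolated T h.2.1 →
      s h = Act.N} := by
    ext s
    simp only [pureCoolOff, Set.mem_ofPred_eq, Set.mem_iInter]
    exact ⟨fun h p => h p.1 p.2.1 p.2.2, fun h t a x => h ⟨t, a, x⟩⟩
  rw [this]
  refine MeasurableSet.iInter fun h => ?_
  exact (MeasurableSet.const _).imp (measurableSet_apply_eq _ _)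

lemma ae_mixedSwitch_mem [Finite X] {T : ℕ → ℕ} {σ : MixedStrategy X}
    (hr : r ∈ pureCoolOff X T)
    (hσ : ∀ᵐ s ∂(σ : Measure (PureStrategy X)), s ∈ pureCoolOff X T) :
    ∀ᵐ s ∂(mixedSwitch C b r σ : Measure (PureStrategy X)), s ∈ pureCoolOff X T := by
  rw [coe_mixedSwitch]
  refine (ae_map_iff (p := (· ∈ pureCoolOff X T)) (measurable_switch C b r).aemeasurable
    (measurableSet_pureCoolOff T)).2 ?_
  filter_upwards [hσ] with s hs
  exact switch_mem_pureCoolOff hr hs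

/-- The signal distribution in the state `θ`, as a real-valued function. -/
noncomputable def sig (f : State → PMF X) (θ : State) (x : X) : ℝ := (f θ x).toReal

lemma sig_nonneg (f : State → PMF X) (θ : State) (x : X) : 0 ≤ sig f θ x := ENNReal.toReal_nonneg

variable [Fintype X]

/-- The private history `h` is an unviolated investment history at which the state with prior
`p'` and signal law `g'` is unlikely compared to the state with prior `p` and signal law `g`. -/
def Confident (T : ℕ → ℕ) (κ p : ℝ) (g : X → ℝ) (p' : ℝ) (g' : X → ℝ) (j : Player)
    (ν : Measure (PureStrategy X)) (h : PrivHist X) : Prop :=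
  IsInv T h.1 h.2.1 ∧ ¬ CoolOffViolated T h.2.1 ∧
    stateWeight p' g' j ν h ≤ κ * stateWeight p g j ν h

lemma sum_sig (f : State → PMF X) (θ : State) : ∑ x, sig f θ x = 1 := by
  simp only [sig]
  rw [← ENNReal.toReal_sum fun x _ => (f θ).apply_ne_top x]
  have h := (f θ).tsum_coe
  rw [tsum_fintype] at h
  rw [h, ENNReal.toReal_one]

/-- Confidence in the high state. -/
noncomputable def High (f : State → PMF X) (p₀ : ℝ) (T : ℕ → ℕ) (κ : ℝ) (j : Player)
    (σ : MixedStrategy X) : PrivHist X → Prop :=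
  Confident T κ p₀ (sig f State.H) (1 - p₀) (sig f State.L) j σ

/-- Confidence in the low state. -/
noncomputable def Low (f : State → PMF X) (p₀ : ℝ) (T : ℕ → ℕ) (κ : ℝ) (j : Player)
    (σ : MixedStrategy X) : PrivHist X → Prop :=
  Confident T κ (1 - p₀) (sig f State.L) p₀ (sig f State.H) j σ

/-- The requirements on the cool-off function and the constants. The players are confident of a
state if its odds are at least `1 / κ`. -/
structure Calibrated (f : State → PMF X) (p₀ c δ : ℝ) (T : ℕ → ℕ) (ε κ : ℝ) : Prop where
  eps_pos : 0 < ε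
  eps_lt : ε < 1
  kappa_pos : 0 < κ
  -- The cool-off phase governed by `T n` must outweigh the likelihood ratios accumulated before it:
  -- one factor `K ^ (n + 1)` for the own signals, one for those behind the opponent's actions.
  slack : ∃ C K : ℝ, 1 ≤ C ∧ 1 - p₀ ≤ C * (κ * p₀) ∧ 1 ≤ K ∧
    (∀ x, sig f State.L x ≤ K * sig f State.H x) ∧
    ∀ n, C * K ^ (2 * (n + 1)) * (∑ x, √(sig f State.H x * sig f State.L x)) ^ T n ≤ ε
  bhattacharyya_le : ∑ x, √(sig f State.H x * sig f State.L x) ≤ (1 - ε) ^ 2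
  -- The immediate gain from investing, less the cost of being wrong about the state, less what the
  -- original strategy may earn once a cool-off of `T₀` periods is over.
  gain_high : ∃ T₀ : ℕ, (∀ n, T₀ ≤ T n) ∧ 0 < (1 - ε - c) - κ / (1 - δ) - δ ^ (T₀ + 1) / (1 - δ)
  gain_low : κ < c * (1 - δ)

/-- The original strategy of the deviator need not satisfy the investment constraint: the switch
makes investment certain at confident histories, and that alone suffices. This is what allows an
infeasible deviation to be repaired. -/
lemma mixedSwitch_high_mem {f : State → PMF X} (hf : ∀ θ x, 0 < f θ x) {p₀ c δ : ℝ}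
    (hp₀ : p₀ ∈ Set.Ioo (0 : ℝ) 1) {T : ℕ → ℕ} {ε κ : ℝ} (hcal : Calibrated f p₀ c δ T ε κ)
    {i j : Player} {σ ν : MixedStrategy X}
    (hσ : ∀ᵐ s ∂(σ : Measure (PureStrategy X)), s ∈ pureCoolOff X T)
    (hν : ν ∈ coolOffStrategies f T ε j) :
    mixedSwitch (High f p₀ T κ j ν) Act.N (alwaysInvest X T) σ ∈ coolOffStrategies f T ε i := by
  have hσ' := ae_mixedSwitch_mem (C := High f p₀ T κ j ν) (b := Act.N) alwaysInvest_mem hσ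
  rw [mem_coolOffStrategies_iff hf] at hν ⊢
  refine ⟨hσ', ?_⟩
  suffices h : ∀ (t : ℕ) (a : ℕ → Profile), IsInv T t (pre a t) →
      ¬ CoolOffViolated T (pre a t) →
      (1 - ε) * reach (sig f State.H) i
        (mixedSwitch (High f p₀ T κ j ν) Act.N (alwaysInvest X T) σ) (pre a t) ≤
      reachAct (sig f State.H) i
        (mixedSwitch (High f p₀ T κ j ν) Act.N (alwaysInvest X T) σ) (pre a t) Act.I by
    intro t a h1 h2
    have : Nonempty Act := ⟨Act.I⟩
    obtain ⟨a, rfl⟩ := exists_pre_eq a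
    exact h t a h1 h2
  obtain ⟨C, K, hC1, hC, hK1, hK, hT⟩ := hcal.slack
  intro t a
  -- The bound at length `t` uses that the deviator's own reach has not decayed too fast, that is,
  -- the constraint at shorter histories.
  induction t using Nat.strong_induction_on with
  | _ t ih =>
    intro h1 h2
    refine constraint_of_invest_high (sig_nonneg f _) (sig_nonneg f _) (sum_sig f _) (sum_sig f _)
      hp₀.1 (sub_pos.2 hp₀.2) hcal.kappa_pos hC1 hC hK1 hK hcal.eps_lt hcal.bhattacharyya_le hT
      (hcal.bhattacharyya_le.trans ?_) hσ' hν.1 h1 h2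
      (fun k hk hk' => ih k hk hk' (not_violated_mono hk.le h2))
      (fun k hk hk' => hν.2 k _ hk' (not_violated_mono hk.le h2)) ?_
    · have := hcal.eps_pos
      have := hcal.eps_lt
      nlinarith
    · intro x hx
      rw [coe_mixedSwitch, ae_map_iff (measurable_switch _ _ _).aemeasurable
        (measurableSet_apply_eq _ _)]
      refine Filter.Eventually.of_forall fun s => ?_
      have hr : alwaysInvest X T ⟨t, pre a t, x⟩ = Act.I := if_pos ⟨h1, h2⟩
      by_cases hs : s ⟨t, pre a t, x⟩ = Act.N
      · rw [switch_of_eq ⟨h1, h2, hx⟩ hs, hr]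
      · rcases switch_eq_or (C := High f p₀ T κ j ν) (b := Act.N) (r := alwaysInvest X T)
          (s := s) ⟨t, pre a t, x⟩ with h | h
        · rw [h, hr]
        · rw [h, eq_I_iff]; exact hs

end Switch

/-! ### The path generated by pure strategies and signals -/

section Play

variable {X : Type*}

/-- The sequence of action profiles generated by pure strategies and signals. -/
def play (s : Player → PureStrategy X) (x : ℕ → Player → X) : ℕ → Profile :=
  fun t => nextProfile s x (playHist s x t)

lemma playHist_eq (s : Player → PureStrategy X) (x : ℕ → Player → X) (t : ℕ) :
    playHist s x t = pre (play s x) t := by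
  induction t with
  | zero => exact funext fun k => k.elim0
  | succ t ih =>
    rw [← snoc_pre, ← ih]
    rfl

lemma play_apply (s : Player → PureStrategy X) (x : ℕ → Player → X) (t : ℕ) (i : Player) :
    play s x t i = s i (node (play s x) (fun n => x n i) t) := by
  rw [node, ← playHist_eq]
  rfl

/-- Reaching `a` amounts to a separate condition on each player's strategy and signals; all product
formulas below come from this. -/
lemma pre_play_eq_iff {s : Player → PureStrategy X} {x : ℕ → Player → X} {t : ℕ} {a : ActHist t} :
    pre (play s x) t = a ↔ ∀ l, ConsistentPure l (s l) a (pre (fun n => x n l) (t + 1)) := by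
  have : Nonempty Act := ⟨Act.I⟩
  obtain ⟨a, rfl⟩ := exists_pre_eq a
  simp only [consistentPure_pre_iff]
  constructor
  · intro h l k hk
    have h1 : pre (play s x) k = pre a k := by
      rw [pre_eq_iff] at h ⊢
      exact fun m hm => h m (hm.trans hk)
    rw [← pre_eq_iff.1 h k hk, play_apply, node, node, h1]
  · intro h
    rw [pre_eq_iff]
    intro k
    induction k using Nat.strong_induction_on with
    | _ k ih =>
      intro hk
      funext l
      rw [play_apply, ← h l k hk, node, node,
        pre_congr (u := play s x) (v := a) fun m hm => ih m hm (hm.trans hk)]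

end Play

/-! ### The law of the draws -/

section Measure

variable {X : Type*} [MeasurableSpace X] {Φ : Player → PureStrategy X → PureStrategy X}

/-- Signals and pure strategies. -/
abbrev Draws (X : Type*) := (ℕ → Player → X) × (Player → PureStrategy X)

/-- The sequence of action profiles if the players transform their strategies by `Φ`. -/
def playMod (Φ : Player → PureStrategy X → PureStrategy X) (w : Draws X) : ℕ → Profile :=
  play (fun l => Φ l (w.2 l)) w.1

lemma measurable_mod (hΦ : ∀ l, Measurable (Φ l)) :
    Measurable (fun w : Draws X => ((w.1, fun l => Φ l (w.2 l)) : Draws X)) := by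
  refine Measurable.prodMk (by fun_prop) (measurable_pi_iff.2 fun l => (hΦ l).comp ?_)
  fun_prop

lemma measurable_signals (l : Player) (n : ℕ) :
    Measurable (fun w : Draws X => pre (fun m => w.1 m l) n) := by
  refine measurable_pi_iff.2 fun k => ?_
  simp only [pre]
  fun_prop

variable [Fintype X] [MeasurableSingletonClass X]

/-- The law of the signals and of the pure strategies in the state `θ`. -/
noncomputable def drawLaw (f : State → PMF X) (σ : Player → MixedStrategy X) (θ : State) :
    Measure (Draws X) :=
  (Measure.infinitePi fun _ : ℕ => Measure.pi fun _ : Player => (f θ).toMeasure).prod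
    (Measure.pi fun i => (σ i : Measure (PureStrategy X)))

instance (f : State → PMF X) (σ : Player → MixedStrategy X) (θ : State) :
    IsProbabilityMeasure (drawLaw f σ θ) := by
  unfold drawLaw; infer_instance

/-- Evaluation at a random history is measurable because the histories of a given length are
countable in number. -/
lemma measurable_eval (t : ℕ) : Measurable
    (fun p : PureStrategy X × (ActHist t × (Fin (t + 1) → X)) => p.1 ⟨t, p.2⟩) :=
    measurable_from_prod_countable_left fun h =>
    measurable_pi_apply (X := fun _ : PrivHist X => Act) ⟨t, h⟩

lemma measurable_play (t : ℕ) : Measurable (fun w : Draws X => play w.2 w.1 t) := by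
  induction t using Nat.strong_induction_on with
  | _ t ih =>
    refine measurable_pi_iff.2 fun l => ?_
    simp only [play_apply]
    refine (measurable_eval t).comp (f := fun w : Draws X =>
      (w.2 l, (pre (play w.2 w.1) t, pre (fun n => w.1 n l) (t + 1)))) ?_
    refine Measurable.prodMk (by fun_prop) (Measurable.prodMk ?_ ?_)
    · exact measurable_pi_iff.2 fun k => ih k k.isLt
    · refine measurable_pi_iff.2 fun k => ?_
      simp only [pre]
      fun_prop

lemma measurable_playMod (hΦ : ∀ l, Measurable (Φ l)) (t : ℕ) :
    Measurable (fun w : Draws X => playMod Φ w t) :=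
  (measurable_play t).comp (measurable_mod hΦ)

lemma measurable_pre_playMod (hΦ : ∀ l, Measurable (Φ l)) (t : ℕ) :
    Measurable (fun w : Draws X => pre (playMod Φ w) t) :=
  measurable_pi_iff.2 fun k => measurable_playMod hΦ k

lemma infinitePi_signals (p : PMF X) (n : ℕ) (z : Player → Fin n → X) :
    (Measure.infinitePi fun _ : ℕ => Measure.pi fun _ : Player => p.toMeasure)
      {x | ∀ l, pre (fun m => x m l) n = z l} = ∏ l, ∏ k, p (z l k) := by
  have hset : {x : ℕ → Player → X | ∀ l, pre (fun m => x m l) n = z l} =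
      Set.pi (Finset.range n) fun m => Set.pi Set.univ fun l =>
        {y | ∀ h : m < n, y = z l ⟨m, h⟩} := by
    ext x
    simp only [Set.mem_ofPred_eq, Set.mem_pi, Finset.coe_range, Set.mem_Iio, Set.mem_univ,
      true_imp_iff, funext_iff, pre]
    exact ⟨fun h m hm l _ => h l ⟨m, hm⟩, fun h l k => h k k.isLt l k.isLt⟩
  rw [hset, Measure.infinitePi_pi]
  · simp only [Measure.pi_pi]
    rw [Finset.prod_comm]
    refine Finset.prod_congr rfl fun l _ => ?_
    rw [Finset.prod_range]
    refine Finset.prod_congr rfl fun k _ => ?_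
    have : {y | ∀ h : (k : ℕ) < n, y = z l ⟨k, h⟩} = {z l k} := by ext y; simp
    rw [this, PMF.toMeasure_apply_singleton _ _ (measurableSet_singleton _)]
  · exact fun m _ => MeasurableSet.univ_pi fun l => Set.Finite.measurableSet (Set.toFinite _)

lemma drawLaw_rect (f : State → PMF X) (σ : Player → MixedStrategy X) (θ : State) {n : ℕ}
    (z : Player → Fin n → X) (B : Player → Set (PureStrategy X)) :
    (drawLaw f σ θ).real {w | (∀ l, pre (fun m => w.1 m l) n = z l) ∧ ∀ l, w.2 l ∈ B l} =
      ∏ l, weight (sig f θ) (z l) * (σ l : Measure (PureStrategy X)).real (B l) := by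
  have hset : {w : Draws X | (∀ l, pre (fun m => w.1 m l) n = z l) ∧ ∀ l, w.2 l ∈ B l} =
      {x : ℕ → Player → X | ∀ l, pre (fun m => x m l) n = z l} ×ˢ Set.pi Set.univ B := by
    ext w; simp
  rw [hset, drawLaw, measureReal_prod_prod, measureReal_def, measureReal_def,
    infinitePi_signals, Measure.pi_pi, ENNReal.toReal_prod, ENNReal.toReal_prod,
    Finset.prod_mul_distrib]
  congr 1
  refine Finset.prod_congr rfl fun l _ => ?_
  rw [ENNReal.toReal_prod]
  rfl

/-- The event splits into finitely many disjoint rectangles, one for each realised action history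
and choice of all signals; each has product probability, and for a fixed action history the sum over
signals factors over the players. -/
lemma drawLaw_mod (f : State → PMF X) (σ : Player → MixedStrategy X) (θ : State)
    (hΦ : ∀ l, Measurable (Φ l)) {t : ℕ}
    (D : Player → ActHist t → (Fin (t + 1) → X) → Set (PureStrategy X))
    (hD : ∀ l a z, MeasurableSet (D l a z)) :
    (drawLaw f σ θ).real {w | ∀ l, w.2 l ∈
        D l (pre (playMod Φ w) t) (pre (fun m => w.1 m l) (t + 1))} =
      ∑ a, ∏ l, ∑ z, weight (sig f θ) z *
        (σ l : Measure (PureStrategy X)).real {s | s ∈ D l a z ∧ ConsistentPure l (Φ l s) a z} := by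
  have hset : {w : Draws X | ∀ l, w.2 l ∈
        D l (pre (playMod Φ w) t) (pre (fun m => w.1 m l) (t + 1))} =
      ⋃ p ∈ (Finset.univ : Finset (ActHist t × (Player → Fin (t + 1) → X))),
        {w | (∀ l, pre (fun m => w.1 m l) (t + 1) = p.2 l) ∧
          ∀ l, w.2 l ∈ {s | s ∈ D l p.1 (p.2 l) ∧ ConsistentPure l (Φ l s) p.1 (p.2 l)}} := by
    ext w
    simp only [Set.mem_ofPred_eq, Set.mem_iUnion, Finset.mem_univ, exists_prop, true_and]
    constructor
    · intro h
      refine ⟨(pre (playMod Φ w) t, fun l => pre (fun m => w.1 m l) (t + 1)), fun l => rfl,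
        fun l => ⟨h l, ?_⟩⟩
      exact pre_play_eq_iff.1 rfl l
    · rintro ⟨⟨a, z⟩, h1, h2⟩ l
      have ha : pre (playMod Φ w) t = a :=
        pre_play_eq_iff.2 fun l => by rw [h1 l]; exact (h2 l).2
      rw [ha, h1 l]
      exact (h2 l).1
  have hmeas : ∀ (p : ActHist t × (Player → Fin (t + 1) → X)) (l : Player), MeasurableSet
      {s | s ∈ D l p.1 (p.2 l) ∧ ConsistentPure l (Φ l s) p.1 (p.2 l)} := fun p l =>
    (hD _ _ _).inter (hΦ l (measurableSet_consistentPure p.1 (p.2 l)))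
  rw [hset, measureReal_biUnion_finset]
  · simp only [drawLaw_rect]
    rw [Fintype.sum_prod_type]
    refine Finset.sum_congr rfl fun a _ => ?_
    rw [Finset.prod_univ_sum]
    simp
  · rintro ⟨a, z⟩ - ⟨a', z'⟩ - hne
    refine Set.disjoint_left.2 fun w hw hw' => hne ?_
    have hz : z = z' := funext fun l => (hw.1 l).symm.trans (hw'.1 l)
    have ha : pre (playMod Φ w) t = a :=
      pre_play_eq_iff.2 fun l => by rw [hw.1 l]; exact (hw.2 l).2
    have ha' : pre (playMod Φ w) t = a' :=
      pre_play_eq_iff.2 fun l => by rw [hw'.1 l]; exact (hw'.2 l).2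
    rw [hz, ← ha, ← ha']
  · intro p _
    refine MeasurableSet.inter ?_ ?_
    · have : {w : Draws X | ∀ l, pre (fun m => w.1 m l) (t + 1) = p.2 l} =
          ⋂ l, (fun w : Draws X => pre (fun m => w.1 m l) (t + 1)) ⁻¹' {p.2 l} := by
        ext; simp
      change MeasurableSet {w : Draws X | _}
      rw [this]
      exact MeasurableSet.iInter fun l =>
        measurable_signals l (t + 1) (measurableSet_singleton _)
    · have : {w : Draws X | ∀ l, w.2 l ∈
            {s | s ∈ D l p.1 (p.2 l) ∧ ConsistentPure l (Φ l s) p.1 (p.2 l)}} =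
          ⋂ l, (fun w : Draws X => w.2 l) ⁻¹'
            {s | s ∈ D l p.1 (p.2 l) ∧ ConsistentPure l (Φ l s) p.1 (p.2 l)} := by
        ext; simp
      change MeasurableSet {w : Draws X | _}
      rw [this]
      exact MeasurableSet.iInter fun l =>
        ((measurable_pi_apply l).comp measurable_snd) (hmeas p l)

end Measure

lemma eq_or_eq_of_ne {i j : Player} (hij : i ≠ j) (l : Player) : l = i ∨ l = j := by
  have h : ∀ i j l : Fin 2, i ≠ j → l = i ∨ l = j := by decide
  exact h i j l hij

lemma prod_player {i j : Player} (hij : i ≠ j) (F : Player → ℝ) : ∏ l, F l = F i * F j :=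
  Fintype.prod_eq_mul i j hij fun l hl => absurd (eq_or_eq_of_ne hij l) (by tauto)

/-! ### Events observable by one player -/

section Events

variable {X : Type*} [Fintype X] [MeasurableSpace X] [MeasurableSingletonClass X]
  {Φ : Player → PureStrategy X → PureStrategy X} {i j : Player} {t : ℕ}
  {A : ActHist t → (Fin (t + 1) → X) → Set (PureStrategy X)}

/-- The event that the pure strategy of player `i` lies in a set depending on the private history
reached. -/
def histEvent (Φ : Player → PureStrategy X → PureStrategy X) (i : Player) {t : ℕ}
    (A : ActHist t → (Fin (t + 1) → X) → Set (PureStrategy X)) : Set (Draws X) :=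
  {w | w.2 i ∈ A (pre (playMod Φ w) t) (pre (fun m => w.1 m i) (t + 1))}

/-- The untransformed opponent enters only through a factor depending on the public history. Both
the constraint on the opponent and the comparison of likelihoods can therefore be applied term by
term. -/
lemma drawLaw_histEvent (f : State → PMF X) (σ : Player → MixedStrategy X) (θ : State)
    (hΦ : ∀ l, Measurable (Φ l)) (hij : i ≠ j) (hj : Φ j = id)
    (hA : ∀ a z, MeasurableSet (A a z)) :
    (drawLaw f σ θ).real (histEvent Φ i A) = ∑ a, (∑ z, weight (sig f θ) z *
      (σ i : Measure (PureStrategy X)).real {s | s ∈ A a z ∧ ConsistentPure i (Φ i s) a z}) *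
        reach (sig f θ) j (σ j) a := by
  have hset : histEvent Φ i A = {w | ∀ l, w.2 l ∈ (fun l a z => if l = i then A a z else Set.univ)
      l (pre (playMod Φ w) t) (pre (fun m => w.1 m l) (t + 1))} := by
    ext w
    simp only [histEvent, Set.mem_ofPred_eq]
    constructor
    · intro h l
      split_ifs with hl
      · subst hl; exact h
      · trivial
    · intro h
      simpa using h i
  rw [hset, drawLaw_mod f σ θ hΦ (fun l a z => if l = i then A a z else Set.univ)]
  · simp only [prod_player hij, if_true, if_neg hij.symm, Set.mem_univ, true_and, hj, id, reach]
  · intro l a z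
    split_ifs
    · exact hA a z
    · exact MeasurableSet.univ

lemma drawLaw_histEvent_inter (f : State → PMF X) (σ : Player → MixedStrategy X) (θ : State)
    (hΦ : ∀ l, Measurable (Φ l)) (hij : i ≠ j) (hj : Φ j = id)
    (hA : ∀ a z, MeasurableSet (A a z)) (b : Act) :
    (drawLaw f σ θ).real (histEvent Φ i A ∩ {w | playMod Φ w t j = b}) =
      ∑ a, (∑ z, weight (sig f θ) z *
      (σ i : Measure (PureStrategy X)).real {s | s ∈ A a z ∧ ConsistentPure i (Φ i s) a z}) *
        reachAct (sig f θ) j (σ j) a b := by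
  have hset : histEvent Φ i A ∩ {w | playMod Φ w t j = b} =
      {w | ∀ l, w.2 l ∈ (fun l a z => if l = i then A a z else {s | s ⟨t, a, z⟩ = b})
      l (pre (playMod Φ w) t) (pre (fun m => w.1 m l) (t + 1))} := by
    ext w
    have hplay : playMod Φ w t j =
        w.2 j ⟨t, pre (playMod Φ w) t, pre (fun m => w.1 m j) (t + 1)⟩ := by
      rw [playMod, play_apply, hj]; rfl
    simp only [histEvent, Set.mem_inter_iff, Set.mem_ofPred_eq, hplay]
    constructor
    · rintro ⟨h1, h2⟩ l
      split_ifs with hl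
      · subst hl; exact h1
      · obtain rfl := (eq_or_eq_of_ne hij l).resolve_left hl
        exact h2
    · intro h
      have h1 := h i
      have h2 := h j
      rw [if_pos rfl] at h1
      rw [if_neg hij.symm] at h2
      exact ⟨h1, h2⟩
  rw [hset, drawLaw_mod f σ θ hΦ (fun l a z => if l = i then A a z else {s | s ⟨t, a, z⟩ = b})]
  · simp only [prod_player hij, if_true, if_neg hij.symm, hj, id, reachAct]
    refine Finset.sum_congr rfl fun a _ => ?_
    congr 1
    refine Finset.sum_congr rfl fun z _ => ?_
    congr 2
    ext s
    simp [and_comm]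
  · intro l a z
    split_ifs
    · exact hA a z
    · exact measurableSet_apply_eq _ _

lemma measurableSet_histEvent (hΦ : ∀ l, Measurable (Φ l)) (hA : ∀ a z, MeasurableSet (A a z)) :
    MeasurableSet (histEvent Φ i A) := by
  have hset : histEvent Φ i A = ⋃ p : ActHist t × (Fin (t + 1) → X),
      ((fun w : Draws X => pre (playMod Φ w) t) ⁻¹' {p.1} ∩
        (fun w : Draws X => pre (fun m => w.1 m i) (t + 1)) ⁻¹' {p.2}) ∩
        (fun w : Draws X => w.2 i) ⁻¹' A p.1 p.2 := by
    ext w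
    simp [histEvent]
  rw [hset]
  exact MeasurableSet.iUnion fun p =>
    ((measurable_pre_playMod hΦ t (measurableSet_singleton _)).inter
      (measurable_signals i (t + 1) (measurableSet_singleton _))).inter
      (((measurable_pi_apply i).comp measurable_snd) (hA _ _))

/-- Conditional on the high state and on any event that player `i` can observe, the opponent
invests with probability at least `1 - ε` at unviolated investment histories. -/
lemma mul_histEvent_le {f : State → PMF X} (hf : ∀ θ x, 0 < f θ x)
    {σ : Player → MixedStrategy X} {T : ℕ → ℕ} {ε : ℝ}
    (hΦ : ∀ l, Measurable (Φ l)) (hij : i ≠ j) (hj : Φ j = id)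
    (hA : ∀ a z, MeasurableSet (A a z)) (hσj : σ j ∈ coolOffStrategies f T ε j)
    (hinv : ∀ a z s, s ∈ A a z → IsInv T t a ∧ ¬ CoolOffViolated T a) :
    (1 - ε) * (drawLaw f σ State.H).real (histEvent Φ i A) ≤
      (drawLaw f σ State.H).real (histEvent Φ i A ∩ {w | playMod Φ w t j = Act.I}) := by
  rw [drawLaw_histEvent f σ _ hΦ hij hj hA, drawLaw_histEvent_inter f σ _ hΦ hij hj hA,
    Finset.mul_sum]
  refine Finset.sum_le_sum fun a _ => ?_
  by_cases ha : IsInv T t a ∧ ¬ CoolOffViolated T a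
  · have h1 : (1 - ε) * reach (sig f State.H) j (σ j) a ≤
        reachAct (sig f State.H) j (σ j) a Act.I :=
      ((mem_coolOffStrategies_iff hf).1 hσj).2 t a ha.1 ha.2
    rw [mul_left_comm]
    exact mul_le_mul_of_nonneg_left h1 (Finset.sum_nonneg fun z _ =>
      mul_nonneg (weight_nonneg (sig_nonneg f _) z) measureReal_nonneg)
  · have h0 : ∑ z, weight (sig f State.H) z * (σ i : Measure (PureStrategy X)).real
        {s | s ∈ A a z ∧ ConsistentPure i (Φ i s) a z} = 0 := by
      refine Finset.sum_eq_zero fun z _ => ?_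
      have : {s | s ∈ A a z ∧ ConsistentPure i (Φ i s) a z} = ∅ := by
        ext s
        simp only [Set.mem_ofPred_eq, Set.mem_empty_iff_false, iff_false, not_and]
        exact fun hs => absurd (hinv a z s hs) ha
      rw [this, measureReal_empty, mul_zero]
    rw [h0]
    simp

/-- Events at which player `i` is confident of the state `θ` are unlikely in the state `θ'`. -/
lemma confident_histEvent_le {f : State → PMF X} {σ : Player → MixedStrategy X} {κ p p' : ℝ}
    {θ θ' : State} (hΦ : ∀ l, Measurable (Φ l)) (hij : i ≠ j) (hj : Φ j = id)
    (hA : ∀ a z, MeasurableSet (A a z))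
    (hconf : ∀ a z s, s ∈ A a z → stateWeight p' (sig f θ') j (σ j) ⟨t, a, z⟩ ≤
      κ * stateWeight p (sig f θ) j (σ j) ⟨t, a, z⟩) :
    p' * (drawLaw f σ θ').real (histEvent Φ i A) ≤
      κ * (p * (drawLaw f σ θ).real (histEvent Φ i A)) := by
  rw [drawLaw_histEvent f σ _ hΦ hij hj hA, drawLaw_histEvent f σ _ hΦ hij hj hA]
  simp only [Finset.mul_sum, Finset.sum_mul]
  refine Finset.sum_le_sum fun a _ => Finset.sum_le_sum fun z _ => ?_
  by_cases hne : ∃ s, s ∈ A a z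
  · obtain ⟨s, hs⟩ := hne
    have h := mul_le_mul_of_nonneg_right (hconf a z s hs) (measureReal_nonneg
      (μ := (σ i : Measure (PureStrategy X)))
      (s := {s | s ∈ A a z ∧ ConsistentPure i (Φ i s) a z}))
    simp only [stateWeight] at h
    linarith
  · have : {s | s ∈ A a z ∧ ConsistentPure i (Φ i s) a z} = ∅ := by
      ext s
      simp only [Set.mem_ofPred_eq, Set.mem_empty_iff_false, iff_false, not_and]
      exact fun hs => absurd ⟨s, hs⟩ hne
    simp [this]

end Events

/-! ### Exponential learning of the state -/

section Learning

variable {X : Type*} [Fintype X]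

lemma reach_snoc {g : X → ℝ} {i : Player} {μ : Measure (PureStrategy X)} {t : ℕ} (a : ActHist t)
    (b : Profile) : reach g i μ (Fin.snoc (α := fun _ => Profile) a b : ActHist (t + 1)) =
      (∑ y, g y) * reachAct g i μ a (b i) := by
  have : Nonempty Act := ⟨Act.I⟩
  obtain ⟨u, hu⟩ := exists_pre_eq (Fin.snoc (α := fun _ => Profile) a b : ActHist (t + 1))
  have h1 : pre u t = a := by
    rw [← Fin.init_snoc (α := fun _ => Profile) (p := a) (x := b), ← hu]
    rfl
  have h2 : u t = b := by
    have := congrFun hu (Fin.last t)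
    rwa [Fin.snoc_last] at this
  rw [← hu, reach_succ, h1, h2]

lemma sum_reachAct [IsFiniteMeasure (α := PureStrategy X) μ] {g : X → ℝ} {i : Player} {t : ℕ}
    (a : ActHist t) : ∑ b, reachAct g i μ a b = reach g i μ a := by
  rw [← reachAct_I_add_reachAct_N]
  exact Finset.sum_pair (by decide)

/-- Given the history, the next actions of the two players sum out separately. With the
Bhattacharyya weight for one player and a probability law for the other, the total is the
coefficient to the power `t + 1`, irrespective of strategies. -/
lemma sum_reach_mul_reach {g h : X → ℝ} {i j : Player} (hij : i ≠ j)
    {μ ν : Measure (PureStrategy X)} [IsProbabilityMeasure μ] [IsProbabilityMeasure ν] (t : ℕ) :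
    ∑ a : ActHist t, reach g i μ a * reach h j ν a =
      (∑ y, g y) ^ (t + 1) * (∑ y, h y) ^ (t + 1) := by
  induction t with
  | zero =>
    have h1 : ∀ (g : X → ℝ) (l : Player) (m : Measure (PureStrategy X)) [IsProbabilityMeasure m]
        (a : ActHist 0), reach g l m a = (∑ y, g y) ^ (0 + 1) := by
      intro g l m _ a
      rw [← sum_weight]
      simp only [reach, consistentPure_zero, Set.ofPred_true, probReal_univ, mul_one]
    simp only [h1]
    simp
  | succ t ih =>
    rw [sum_snoc]
    simp only [reach_snoc]
    have h2 : ∀ a : ActHist t, ∑ b : Profile, reachAct g i μ a (b i) * reachAct h j ν a (b j) =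
        reach g i μ a * reach h j ν a := by
      intro a
      have h3 := Finset.prod_univ_sum (fun _ : Player => (Finset.univ : Finset Act))
        (fun l c => if l = i then reachAct g i μ a c else reachAct h j ν a c)
      rw [prod_player hij] at h3
      simp only [prod_player hij, if_true, if_neg hij.symm, sum_reachAct,
        Fintype.piFinset_univ] at h3
      exact h3.symm
    calc _ = ∑ a : ActHist t, ((∑ y, g y) * ∑ y, h y) *
          ∑ b : Profile, reachAct g i μ a (b i) * reachAct h j ν a (b j) := by
          refine Finset.sum_congr rfl fun a _ => ?_
          rw [Finset.mul_sum]
          exact Finset.sum_congr rfl fun b _ => by ring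
      _ = _ := by
          simp only [h2, ← Finset.mul_sum, ih]
          ring

variable [MeasurableSpace X] [MeasurableSingletonClass X]

/-- The probability that a player is not confident of the true state decays exponentially. -/
lemma not_confident_le {f : State → PMF X} {σ : Player → MixedStrategy X} {κ p p' : ℝ}
    {θ θ' : State} {i j : Player} (hij : i ≠ j) (hp : 0 < p) (hp' : 0 < p') (hκ : 0 < κ) (t : ℕ) :
    (drawLaw f σ θ).real (histEvent (fun _ => id) i fun (a : ActHist t) z => {_s |
      ¬ stateWeight p' (sig f θ') j (σ j) ⟨t, a, z⟩ ≤
        κ * stateWeight p (sig f θ) j (σ j) ⟨t, a, z⟩}) ≤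
    (1 + p' / (κ * p)) * (∑ x, √(sig f θ x * sig f θ' x)) ^ (t + 1) := by
  rw [drawLaw_histEvent f σ _ (fun _ => measurable_id) hij rfl fun a z => MeasurableSet.const _]
  -- The summand `1` ensures `C ≤ C ^ 2`, needed after taking square roots.
  set C := 1 + p' / (κ * p) with hC
  have hq : 0 < p' / (κ * p) := by positivity
  set g : X → ℝ := fun x => √(sig f θ x * sig f θ' x) with hg
  have hg0 : ∀ x, 0 ≤ g x := fun x => Real.sqrt_nonneg _
  have hsum : ∑ a : ActHist t, C * (reach g i (σ i) a *
      ((reach (sig f θ) j (σ j) a + reach (sig f θ') j (σ j) a) / 2)) =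
      C * (∑ x, g x) ^ (t + 1) := by
    rw [← Finset.mul_sum]
    congr 1
    have e1 := sum_reach_mul_reach (g := g) (h := sig f θ) hij
      (μ := (σ i : Measure (PureStrategy X))) (ν := (σ j : Measure (PureStrategy X))) t
    have e2 := sum_reach_mul_reach (g := g) (h := sig f θ') hij
      (μ := (σ i : Measure (PureStrategy X))) (ν := (σ j : Measure (PureStrategy X))) t
    rw [sum_sig, one_pow, mul_one] at e1 e2
    have : ∀ a : ActHist t, reach g i (σ i) a *
        ((reach (sig f θ) j (σ j) a + reach (sig f θ') j (σ j) a) / 2) =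
        (reach g i (σ i) a * reach (sig f θ) j (σ j) a) / 2 +
          (reach g i (σ i) a * reach (sig f θ') j (σ j) a) / 2 := fun a => by ring
    simp only [this, Finset.sum_add_distrib, ← Finset.sum_div, e1, e2]
    ring
  rw [← hsum]
  refine Finset.sum_le_sum fun a _ => ?_
  have hreach : reach g i (σ i) a = ∑ z, weight g z *
      (σ i : Measure (PureStrategy X)).real {s | ConsistentPure i s a z} := rfl
  rw [hreach, Finset.sum_mul, Finset.sum_mul, Finset.mul_sum]
  refine Finset.sum_le_sum fun z _ => ?_
  have hW := reach_nonneg (g := sig f θ) (sig_nonneg f _) (i := j)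
    (μ := (σ j : Measure (PureStrategy X))) a
  have hW' := reach_nonneg (g := sig f θ') (sig_nonneg f _) (i := j)
    (μ := (σ j : Measure (PureStrategy X))) a
  have hw := weight_nonneg (sig_nonneg f θ) z
  have hw' := weight_nonneg (sig_nonneg f θ') z
  have hwg := weight_nonneg hg0 z
  have hwg2 := weight_sqrt_sq (sig_nonneg f θ) (sig_nonneg f θ') z
  have hm : 0 ≤ (σ i : Measure (PureStrategy X)).real {s | ConsistentPure i s a z} :=
    measureReal_nonneg
  by_cases hx : stateWeight p' (sig f θ') j (σ j) ⟨t, a, z⟩ ≤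
        κ * stateWeight p (sig f θ) j (σ j) ⟨t, a, z⟩
  · simp only [hx, not_true_eq_false, Set.ofPred_false, Set.mem_empty_iff_false, false_and,
      measureReal_empty, mul_zero, zero_mul]
    positivity
  · simp only [hx, not_false_eq_true, Set.ofPred_true, Set.mem_univ, true_and, id]
    -- Without confidence, `w W ≤ C w' W'`, so `w W` is at most `C` times `√(w w') √(W W')`. The
    -- first root is a product weight; the second is replaced by the mean of `W` and `W'`, because
    -- the means can be summed over histories.
    have key : weight (sig f θ) z * reach (sig f θ) j (σ j) a ≤ C * (weight g z *
        ((reach (sig f θ) j (σ j) a + reach (sig f θ') j (σ j) a) / 2)) := by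
      simp only [stateWeight, not_le] at hx
      set w := weight (sig f θ) z
      set w' := weight (sig f θ') z
      set W := reach (sig f θ) j (σ j) a
      set W' := reach (sig f θ') j (σ j) a
      have h1 : w * W ≤ C * (w' * W') := by
        have : w * W ≤ p' / (κ * p) * (w' * W') := by
          rw [div_mul_eq_mul_div, le_div_iff₀ (by positivity)]
          linarith
        refine this.trans (mul_le_mul_of_nonneg_right ?_ (by positivity))
        linarith
      refine le_of_sq_le_sq ?_ (by positivity)
      calc (w * W) ^ 2 = (w * W) * (w * W) := sq _
        _ ≤ (w * W) * (C * (w' * W')) := mul_le_mul_of_nonneg_left h1 (by positivity)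
        _ = C * ((weight g z) ^ 2 * (W * W')) := by rw [hwg2]; ring
        _ ≤ C ^ 2 * ((weight g z) ^ 2 * ((W + W') / 2) ^ 2) := by
            have h2 : W * W' ≤ ((W + W') / 2) ^ 2 := by nlinarith [sq_nonneg (W - W')]
            have h3 : C ≤ C ^ 2 := by nlinarith
            gcongr
        _ = _ := by ring
    calc _ = (weight (sig f θ) z * reach (sig f θ) j (σ j) a) *
          (σ i : Measure (PureStrategy X)).real {s | ConsistentPure i s a z} := by ring
      _ ≤ (C * (weight g z * ((reach (sig f θ) j (σ j) a + reach (sig f θ') j (σ j) a) / 2))) *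
          (σ i : Measure (PureStrategy X)).real {s | ConsistentPure i s a z} :=
        mul_le_mul_of_nonneg_right key hm
      _ = _ := by ring

end Learning

/-! ### Bounds on the stage payoff -/

section StagePayoff

lemma stagePayoff_of_N {c : ℝ} {a : Profile} {θ : State} {i : Player} (h : a i = Act.N) :
    stagePayoff c a θ i = 0 := by
  simp [stagePayoff, h]

lemma stagePayoff_L_of_I {c : ℝ} {a : Profile} {i : Player} (h : a i = Act.I) :
    stagePayoff c a State.L i = -c := by
  simp [stagePayoff, h]

lemma stagePayoff_le_one {c : ℝ} (hc : 0 ≤ c) (a : Profile) (θ : State) (i : Player) :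
    stagePayoff c a θ i ≤ 1 := by
  unfold stagePayoff; split_ifs <;> linarith

lemma neg_one_le_stagePayoff {c : ℝ} (hc : c ≤ 1) (a : Profile) (θ : State) (i : Player) :
    -1 ≤ stagePayoff c a θ i := by
  unfold stagePayoff; split_ifs <;> linarith

lemma stagePayoff_L_nonpos {c : ℝ} (hc : 0 ≤ c) (a : Profile) (i : Player) :
    stagePayoff c a State.L i ≤ 0 := by
  unfold stagePayoff; split_ifs <;> simp_all

lemma abs_stagePayoff_le {c : ℝ} (hc : c ∈ Set.Ioo (0 : ℝ) 1) (a : Profile) (θ : State)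
    (i : Player) : |stagePayoff c a θ i| ≤ 1 :=
  abs_le.2 ⟨neg_one_le_stagePayoff hc.2.le a θ i, stagePayoff_le_one hc.1.le a θ i⟩

lemma measurable_stagePayoff (c : ℝ) (θ : State) (i : Player) :
    Measurable (fun a : Profile => stagePayoff c a θ i) := Measurable.of_discrete

end StagePayoff

/-! ### The long-run payoff as a discounted sum -/

section Payoff

variable {X : Type*} [MeasurableSpace X]

/-- The expected payoff of player `i` in period `t + 1` in the state `θ` if the players transform
their strategies by `Φ`. -/
noncomputable def meanPayoff (f : State → PMF X) (σ : Player → MixedStrategy X) (c : ℝ)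
    (Φ : Player → PureStrategy X → PureStrategy X) (θ : State) (i : Player) (t : ℕ) : ℝ :=
  ∫ w, stagePayoff c (playMod Φ w t) θ i ∂drawLaw f σ θ

lemma abs_meanPayoff_le (f : State → PMF X) (σ : Player → MixedStrategy X) {c : ℝ}
    (hc : c ∈ Set.Ioo (0 : ℝ) 1) (Φ : Player → PureStrategy X → PureStrategy X) (θ : State)
    (i : Player) (t : ℕ) : |meanPayoff f σ c Φ θ i t| ≤ 1 := by
  have := norm_integral_le_of_norm_le_const (μ := drawLaw f σ θ) (C := 1)
    (f := fun w => stagePayoff c (playMod Φ w t) θ i)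
    (Filter.Eventually.of_forall fun _ => abs_stagePayoff_le hc _ _ _)
  simpa [meanPayoff] using this

/-- The unweighted payoff stream in expectation over the state. -/
noncomputable def priorMean (p₀ : ℝ) (f : State → PMF X) (σ : Player → MixedStrategy X) (c : ℝ)
    (Φ : Player → PureStrategy X → PureStrategy X) (i : Player) (t : ℕ) : ℝ :=
  p₀ * meanPayoff f σ c Φ State.H i t + (1 - p₀) * meanPayoff f σ c Φ State.L i t

lemma abs_priorMean_le {p₀ : ℝ} (hp₀ : p₀ ∈ Set.Ioo (0 : ℝ) 1) (f : State → PMF X)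
    (σ : Player → MixedStrategy X) {c : ℝ}
    (hc : c ∈ Set.Ioo (0 : ℝ) 1) (Φ : Player → PureStrategy X → PureStrategy X)
    (i : Player) (t : ℕ) : |priorMean p₀ f σ c Φ i t| ≤ 1 := by
  have h1 := abs_le.1 (abs_meanPayoff_le f σ hc Φ State.H i t)
  have h2 := abs_le.1 (abs_meanPayoff_le f σ hc Φ State.L i t)
  have h3 := hp₀.1
  have h4 : 0 < 1 - p₀ := sub_pos.2 hp₀.2
  refine abs_le.2 ⟨?_, ?_⟩ <;> unfold priorMean <;> nlinarith

lemma summable_priorMean {p₀ : ℝ} (hp₀ : p₀ ∈ Set.Ioo (0 : ℝ) 1) (f : State → PMF X)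
    (σ : Player → MixedStrategy X) {c δ : ℝ} (hc : c ∈ Set.Ioo (0 : ℝ) 1)
    (hδ : δ ∈ Set.Ioo (0 : ℝ) 1) (Φ : Player → PureStrategy X → PureStrategy X) (i : Player) :
    Summable fun t => δ ^ t * priorMean p₀ f σ c Φ i t := by
  refine Summable.of_norm_bounded (summable_geometric_of_lt_one hδ.1.le hδ.2) fun t => ?_
  rw [norm_mul, Real.norm_of_nonneg (pow_nonneg hδ.1.le t)]
  exact mul_le_of_le_one_right (pow_nonneg hδ.1.le t) (abs_priorMean_le hp₀ f σ hc Φ i t)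

variable [Fintype X]

lemma drawLaw_map {Φ : Player → PureStrategy X → PureStrategy X} (hΦ : ∀ l, Measurable (Φ l))
    (f : State → PMF X) {σ σ' : Player → MixedStrategy X} (θ : State)
    (hσ : ∀ l, (σ' l : Measure (PureStrategy X)) = (σ l : Measure (PureStrategy X)).map (Φ l)) :
    drawLaw f σ' θ = (drawLaw f σ θ).map fun w => (w.1, fun l => Φ l (w.2 l)) := by
  have h1 : ∀ l, IsProbabilityMeasure ((σ l : Measure (PureStrategy X)).map (Φ l)) :=
    fun l => Measure.isProbabilityMeasure_map (hΦ l).aemeasurable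
  have h2 := Measure.pi_map_pi (μ := fun l => (σ l : Measure (PureStrategy X))) (f := Φ)
    fun l => (hΦ l).aemeasurable
  have h3 : Measurable fun s : Player → PureStrategy X => fun l => Φ l (s l) :=
    measurable_pi_iff.2 fun l => (hΦ l).comp (measurable_pi_apply l)
  simp only [drawLaw, hσ]
  rw [← h2]
  conv_lhs => rw [← Measure.map_id
    (μ := Measure.infinitePi fun _ : ℕ => Measure.pi fun _ : Player => (f θ).toMeasure)]
  rw [Measure.map_prod_map _ _ measurable_id h3]
  rfl

variable [MeasurableSingletonClass X]

lemma integrable_stagePayoff {Φ : Player → PureStrategy X → PureStrategy X}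
    (hΦ : ∀ l, Measurable (Φ l)) (f : State → PMF X) (σ : Player → MixedStrategy X) {c : ℝ}
    (hc : c ∈ Set.Ioo (0 : ℝ) 1) (θ θ' : State) (i : Player) (t : ℕ) :
    Integrable (fun w => stagePayoff c (playMod Φ w t) θ i) (drawLaw f σ θ') :=
  Integrable.of_bound
    ((measurable_stagePayoff c θ i).comp (measurable_playMod hΦ t)).aestronglyMeasurable 1
    (Filter.Eventually.of_forall fun _ => abs_stagePayoff_le hc _ _ _)

lemma measurable_outcome (θ : State) : Measurable (outcome (X := X) θ) := by
  refine Measurable.prodMk measurable_const (Measurable.prodMk measurable_fst ?_)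
  exact measurable_pi_iff.2 fun t => measurable_play t

/-- The payoff of the transformed profile is expressed under the draws of the original one. This
couples play before and after a deviation on one probability space. -/
lemma payoff_eq_tsum {p₀ : ℝ} (hp₀ : p₀ ∈ Set.Ioo (0 : ℝ) 1) (f : State → PMF X)
    {σ σ' : Player → MixedStrategy X} {c δ : ℝ} (hc : c ∈ Set.Ioo (0 : ℝ) 1)
    (hδ : δ ∈ Set.Ioo (0 : ℝ) 1) {Φ : Player → PureStrategy X → PureStrategy X}
    (hΦ : ∀ l, Measurable (Φ l))
    (hσ : ∀ l, (σ' l : Measure (PureStrategy X)) = (σ l : Measure (PureStrategy X)).map (Φ l))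
    (i : Player) :
    payoff p₀ f c δ σ' i = (1 - δ) * ∑' t, δ ^ t * priorMean p₀ f σ c Φ i t := by
  have hu : Measurable fun p : State × Profile => stagePayoff c p.2 p.1 i := Measurable.of_discrete
  have hmeas : ∀ t, Measurable fun ω : PathSpace X =>
      (1 - δ) * δ ^ t * stagePayoff c (ω.2.2 t) ω.1 i := by
    intro t
    refine measurable_const.mul (hu.comp (f := fun ω : PathSpace X => (ω.1, ω.2.2 t)) ?_)
    fun_prop
  have hbound : ∀ t (ω : PathSpace X),
      ‖(1 - δ) * δ ^ t * stagePayoff c (ω.2.2 t) ω.1 i‖ ≤ (1 - δ) * δ ^ t := by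
    intro t ω
    have h1 : 0 ≤ (1 - δ) * δ ^ t := mul_nonneg (by linarith [hδ.2]) (pow_nonneg hδ.1.le t)
    rw [norm_mul, Real.norm_of_nonneg h1]
    exact mul_le_of_le_one_right h1 (abs_stagePayoff_le hc _ _ _)
  have hfinG : ∀ θ, IsProbabilityMeasure (pathLawGiven f σ' θ) := fun θ =>
    Measure.isProbabilityMeasure_map (μ := drawLaw f σ' θ) (measurable_outcome θ).aemeasurable
  have hint : ∀ t θ, Integrable (fun ω : PathSpace X =>
      (1 - δ) * δ ^ t * stagePayoff c (ω.2.2 t) ω.1 i) (pathLawGiven f σ' θ) := fun t θ =>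
    Integrable.of_bound (hmeas t).aestronglyMeasurable _ (Filter.Eventually.of_forall (hbound t))
  have hgiven : ∀ θ, ∫ ω, ∑' t : ℕ, (1 - δ) * δ ^ t * stagePayoff c (ω.2.2 t) ω.1 i
      ∂(pathLawGiven f σ' θ) = ∑' t, (1 - δ) * δ ^ t * meanPayoff f σ c Φ θ i t := by
    intro θ
    rw [← integral_tsum_of_summable_integral_norm (fun t => hint t θ)]
    · refine tsum_congr fun t => ?_
      have h1 : pathLawGiven f σ' θ = (drawLaw f σ' θ).map (outcome θ) := rfl
      rw [integral_const_mul, h1, drawLaw_map hΦ f θ hσ,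
        Measure.map_map (measurable_outcome θ) (measurable_mod hΦ), integral_map]
      · rfl
      · exact ((measurable_outcome θ).comp (measurable_mod hΦ)).aemeasurable
      · refine (hu.comp (f := fun ω : PathSpace X => (ω.1, ω.2.2 t)) ?_).aestronglyMeasurable
        fun_prop
    · refine Summable.of_nonneg_of_le (fun t => integral_nonneg fun ω => norm_nonneg _)
        (fun t => ?_) ((summable_geometric_of_lt_one hδ.1.le hδ.2).mul_left (1 - δ))
      have := integral_mono (hint t θ).norm (integrable_const ((1 - δ) * δ ^ t)) (hbound t)
      simpa using this
  have hsum : ∀ θ, Summable fun t => (1 - δ) * δ ^ t * meanPayoff f σ c Φ θ i t := by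
    intro θ
    refine Summable.of_norm_bounded
      ((summable_geometric_of_lt_one hδ.1.le hδ.2).mul_left (1 - δ)) fun t => ?_
    have h1 : 0 ≤ (1 - δ) * δ ^ t := mul_nonneg (by linarith [hδ.2]) (pow_nonneg hδ.1.le t)
    rw [norm_mul, Real.norm_of_nonneg h1]
    exact mul_le_of_le_one_right h1 (abs_meanPayoff_le f σ hc Φ θ i t)
  have hintS : ∀ θ, Integrable (fun ω : PathSpace X =>
      ∑' t : ℕ, (1 - δ) * δ ^ t * stagePayoff c (ω.2.2 t) ω.1 i) (pathLawGiven f σ' θ) := by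
    intro θ
    refine Integrable.of_bound (C := ∑' t : ℕ, (1 - δ) * δ ^ t) ?_
      (Filter.Eventually.of_forall fun ω => ?_)
    · have hlim : ∀ ω : PathSpace X, HasSum
          (fun t : ℕ => (1 - δ) * δ ^ t * stagePayoff c (ω.2.2 t) ω.1 i)
          (∑' t : ℕ, (1 - δ) * δ ^ t * stagePayoff c (ω.2.2 t) ω.1 i) := fun ω =>
        (Summable.of_norm_bounded ((summable_geometric_of_lt_one hδ.1.le hδ.2).mul_left (1 - δ))
          fun t => hbound t ω).hasSum
      exact (measurable_of_tendsto_metrizable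
        (fun n => Finset.measurable_fun_sum (Finset.range n) fun t _ => hmeas t)
        (tendsto_pi_nhds.2 fun ω => (hlim ω).tendsto_sum_nat)).aestronglyMeasurable
    · exact tsum_of_norm_bounded
        ((summable_geometric_of_lt_one hδ.1.le hδ.2).mul_left (1 - δ)).hasSum fun t => hbound t ω
  unfold payoff pathLaw
  rw [integral_add_measure ((hintS _).smul_measure ENNReal.ofReal_ne_top)
    ((hintS _).smul_measure ENNReal.ofReal_ne_top), integral_smul_measure, integral_smul_measure,
    hgiven, hgiven, ENNReal.toReal_ofReal hp₀.1.le, ENNReal.toReal_ofReal (by linarith [hp₀.2]),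
    smul_eq_mul, smul_eq_mul, ← tsum_mul_left, ← tsum_mul_left, ← tsum_mul_left,
    ← Summable.tsum_add ((hsum _).mul_left _) ((hsum _).mul_left _)]
  refine tsum_congr fun t => ?_
  unfold priorMean
  ring

end Payoff

/-! ### Summing gains over switching times -/

section Convolution

/-- The gain in period `t` is a sum over switching times `m` of a probability `A m` times a bound
depending on the elapsed time `t - m`; discounting makes this a Cauchy product. The sign of the
total then rests on the single series in `lam`. -/
lemma conv_le_tsum {δ M : ℝ} (hδ : δ ∈ Set.Ioo (0 : ℝ) 1) {A lam d : ℕ → ℝ}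
    (hA0 : ∀ m, 0 ≤ A m) (hA1 : ∀ m, A m ≤ 1) (hlam : ∀ k, |lam k| ≤ M)
    (hd : Summable fun t => δ ^ t * d t)
    (h : ∀ t, ∑ m ∈ Finset.range (t + 1), A m * lam (t - m) ≤ d t) :
    (∑' m, δ ^ m * A m) * (∑' k, δ ^ k * lam k) ≤ ∑' t, δ ^ t * d t := by
  have hgeo := summable_geometric_of_lt_one hδ.1.le hδ.2
  have hpow : ∀ k, 0 ≤ δ ^ k := fun k => pow_nonneg hδ.1.le k
  have h1 : Summable fun m => ‖δ ^ m * A m‖ := by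
    refine Summable.of_nonneg_of_le (fun _ => norm_nonneg _) (fun m => ?_) hgeo
    rw [Real.norm_of_nonneg (mul_nonneg (hpow m) (hA0 m))]
    exact mul_le_of_le_one_right (hpow m) (hA1 m)
  have h2 : Summable fun k => ‖δ ^ k * lam k‖ := by
    refine Summable.of_nonneg_of_le (fun _ => norm_nonneg _) (fun k => ?_) (hgeo.mul_right M)
    rw [norm_mul, Real.norm_of_nonneg (hpow k)]
    exact mul_le_mul_of_nonneg_left (hlam k) (hpow k)
  rw [tsum_mul_tsum_eq_tsum_sum_range_of_summable_norm h1 h2]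
  refine Summable.tsum_le_tsum (fun t => ?_)
    (summable_norm_sum_mul_range_of_summable_norm h1 h2).of_norm hd
  calc ∑ m ∈ Finset.range (t + 1), δ ^ m * A m * (δ ^ (t - m) * lam (t - m))
      = δ ^ t * ∑ m ∈ Finset.range (t + 1), A m * lam (t - m) := by
        rw [Finset.mul_sum]
        refine Finset.sum_congr rfl fun m hm => ?_
        have : δ ^ t = δ ^ m * δ ^ (t - m) := by
          rw [← pow_add]; congr 1; have := Finset.mem_range.1 hm; omega
        rw [this]; ring
    _ ≤ δ ^ t * d t := mul_le_mul_of_nonneg_left (h t) (hpow t)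

end Convolution

/-! ### Coupling the original and the switched play -/

section Switching

variable {X : Type*}

/-- The pure strategies that choose `b` at `h`, where `C` holds, and for which this did not happen
earlier on the way to `h`. -/
def firstSwitch (C : PrivHist X → Prop) (b : Act) (h : PrivHist X) : Set (PureStrategy X) :=
  {s | (C h ∧ s h = b) ∧
    ∀ (k : ℕ) (hk : k < h.1), ¬ (C (trunc h k hk.le) ∧ s (trunc h k hk.le) = b)}

/-- Only player `i` transforms the strategy. -/
def modAt (i : Player) (Ψ : PureStrategy X → PureStrategy X) :
    Player → PureStrategy X → PureStrategy X :=
  Function.update (fun _ => id) i Ψ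

variable {C : PrivHist X → Prop} {b : Act} {r : PureStrategy X} {i j : Player}

lemma modAt_self (Ψ : PureStrategy X → PureStrategy X) : modAt i Ψ i = Ψ :=
  Function.update_self ..

lemma modAt_of_ne (Ψ : PureStrategy X → PureStrategy X) (hij : i ≠ j) : modAt i Ψ j = id :=
  Function.update_of_ne hij.symm _ _

lemma mem_firstSwitch_node {a : ℕ → Profile} {x : ℕ → X} {m : ℕ} {s : PureStrategy X} :
    s ∈ firstSwitch C b (node a x m) ↔ (C (node a x m) ∧ s (node a x m) = b) ∧
      ∀ k < m, ¬ (C (node a x k) ∧ s (node a x k) = b) := Iff.rfl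

lemma measurableSet_firstSwitch (C : PrivHist X → Prop) (b : Act) (h : PrivHist X) :
    MeasurableSet (firstSwitch C b h) := by
  have : firstSwitch C b h = {s | C h ∧ s h = b} ∩ ⋂ (k : ℕ) (hk : k < h.1),
      {s | C (trunc h k hk.le) ∧ s (trunc h k hk.le) = b}ᶜ := by
    ext s; simp [firstSwitch]
  rw [this]
  have key : ∀ h : PrivHist X, MeasurableSet {s : PureStrategy X | C h ∧ s h = b} := fun h =>
    (MeasurableSet.const _).inter (measurableSet_apply_eq h b)
  exact (key h).inter (MeasurableSet.iInter fun k => MeasurableSet.iInter fun hk => (key _).compl)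

/-- The actions without any transformation. -/
def playOrig (w : Draws X) : ℕ → Profile := play w.2 w.1

/-- The own signals of player `i`. -/
def ownSignals (i : Player) (w : Draws X) : ℕ → X := fun n => w.1 n i

/-- The actions if player `i` uses `switch C b r`. -/
noncomputable def playSwitch (C : PrivHist X → Prop) (b : Act) (r : PureStrategy X) (i : Player)
    (w : Draws X) : ℕ → Profile :=
  playMod (modAt i (switch C b r)) w

/-- The event that player `i` first switches at the private history of length `m`. -/
def switchEvent (C : PrivHist X → Prop) (b : Act) (r : PureStrategy X) (i : Player) (m : ℕ) :
    Set (Draws X) :=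
  histEvent (modAt i (switch C b r)) i fun (a : ActHist m) z => firstSwitch C b ⟨m, a, z⟩

lemma mem_switchEvent {m : ℕ} {w : Draws X} : w ∈ switchEvent C b r i m ↔
    w.2 i ∈ firstSwitch C b (node (playSwitch C b r i w) (ownSignals i w) m) := Iff.rfl

lemma playOrig_apply (w : Draws X) (t : ℕ) (l : Player) :
    playOrig w t l = w.2 l (node (playOrig w) (ownSignals l w) t) := play_apply _ _ _ _

lemma playSwitch_apply_self (w : Draws X) (t : ℕ) : playSwitch C b r i w t i =
    switch C b r (w.2 i) (node (playSwitch C b r i w) (ownSignals i w) t) := by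
  rw [playSwitch, playMod, play_apply, modAt_self]; rfl

lemma playSwitch_apply_other (hij : i ≠ j) (w : Draws X) (t : ℕ) : playSwitch C b r i w t j =
    w.2 j (node (playSwitch C b r i w) (ownSignals j w) t) := by
  rw [playSwitch, playMod, play_apply, modAt_of_ne _ hij]; rfl

lemma node_congr {a a' : ℕ → Profile} {x : ℕ → X} {t : ℕ} (h : pre a t = pre a' t) :
    node a x t = node a' x t := by rw [node, node, h]

lemma exists_ne (i : Player) : ∃ j : Player, i ≠ j := by
  have h : ∀ i : Fin 2, ∃ j : Fin 2, i ≠ j := by decide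
  exact h i

lemma playSwitch_step {w : Draws X} {t : ℕ}
    (hpre : pre (playSwitch C b r i w) t = pre (playOrig w) t)
    (h : ∀ k ≤ t, ¬ (C (node (playSwitch C b r i w) (ownSignals i w) k) ∧
      w.2 i (node (playSwitch C b r i w) (ownSignals i w) k) = b)) :
    playSwitch C b r i w t = playOrig w t := by
  funext l
  obtain ⟨j, hij⟩ := exists_ne i
  rcases eq_or_eq_of_ne hij l with rfl | rfl
  · rw [playSwitch_apply_self, switch_node_of_forall h, playOrig_apply, node_congr hpre]
  · rw [playSwitch_apply_other hij, playOrig_apply, node_congr hpre]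

lemma pre_playSwitch_eq {w : Draws X} {m : ℕ}
    (h : ∀ k < m, ¬ (C (node (playSwitch C b r i w) (ownSignals i w) k) ∧
      w.2 i (node (playSwitch C b r i w) (ownSignals i w) k) = b)) :
    pre (playSwitch C b r i w) m = pre (playOrig w) m := by
  induction m with
  | zero => exact funext fun k => k.elim0
  | succ m ih =>
    have hm := ih fun k hk => h k (hk.trans (Nat.lt_succ_self m))
    rw [← snoc_pre, ← snoc_pre, hm, playSwitch_step hm fun k hk => h k (Nat.lt_succ_of_le hk)]

/-- The absence of a switch may be checked along the original path, since by induction the two paths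
coincide until the first switch. -/
lemma pre_playSwitch_eq' {w : Draws X} {m : ℕ}
    (h : ∀ k < m, ¬ (C (node (playOrig w) (ownSignals i w) k) ∧
      w.2 i (node (playOrig w) (ownSignals i w) k) = b)) :
    pre (playSwitch C b r i w) m = pre (playOrig w) m := by
  refine pre_playSwitch_eq ?_
  induction m with
  | zero => intro k hk; omega
  | succ m ih =>
    have ih' := ih fun k hk => h k (hk.trans (Nat.lt_succ_self m))
    intro k hk
    rcases Nat.lt_succ_iff_lt_or_eq.1 hk with hk | rfl
    · exact ih' k hk
    · rw [node_congr (pre_playSwitch_eq ih')]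
      exact h k hk

/-- Whoever would switch at some point switches first at some point. -/
lemma exists_mem_switchEvent {w : Draws X} {n : ℕ}
    (h : C (node (playOrig w) (ownSignals i w) n) ∧
      w.2 i (node (playOrig w) (ownSignals i w) n) = b) :
    ∃ m ≤ n, w ∈ switchEvent C b r i m := by
  classical
  have hex : ∃ n, C (node (playOrig w) (ownSignals i w) n) ∧
      w.2 i (node (playOrig w) (ownSignals i w) n) = b := ⟨n, h⟩
  refine ⟨Nat.find hex, Nat.find_min' hex h, ?_⟩
  have hmin : ∀ k < Nat.find hex, ¬ (C (node (playOrig w) (ownSignals i w) k) ∧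
      w.2 i (node (playOrig w) (ownSignals i w) k) = b) := fun k hk => Nat.find_min hex hk
  have hpre : ∀ k ≤ Nat.find hex,
      pre (playSwitch C b r i w) k = pre (playOrig w) k := fun k hk =>
    pre_playSwitch_eq' fun l hl => hmin l (hl.trans_le hk)
  rw [mem_switchEvent, mem_firstSwitch_node]
  refine ⟨?_, fun k hk => ?_⟩
  · rw [node_congr (hpre _ le_rfl)]; exact Nat.find_spec hex
  · rw [node_congr (hpre k hk.le)]; exact hmin k hk

lemma pre_eq_of_mem_switchEvent {w : Draws X} {m : ℕ} (h : w ∈ switchEvent C b r i m) :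
    pre (playSwitch C b r i w) m = pre (playOrig w) m :=
  pre_playSwitch_eq (mem_firstSwitch_node.1 h).2

lemma playSwitch_of_mem_switchEvent {w : Draws X} {m t : ℕ} (h : w ∈ switchEvent C b r i m)
    (hmt : m ≤ t) : playSwitch C b r i w t i =
      r (node (playSwitch C b r i w) (ownSignals i w) t) := by
  rw [playSwitch_apply_self]
  exact switch_node_of_exists ⟨m, hmt, (mem_firstSwitch_node.1 h).1⟩

lemma playOrig_of_mem_switchEvent {w : Draws X} {m : ℕ} (h : w ∈ switchEvent C b r i m) :
    playOrig w m i = b := by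
  rw [playOrig_apply, ← node_congr (pre_eq_of_mem_switchEvent h)]
  exact (mem_firstSwitch_node.1 h).1.2

lemma playSwitch_eq_of_forall_notMem {w : Draws X} {t : ℕ}
    (h : ∀ m ≤ t, w ∉ switchEvent C b r i m) : playSwitch C b r i w t = playOrig w t := by
  have hno : ∀ k ≤ t, ¬ (C (node (playOrig w) (ownSignals i w) k) ∧
      w.2 i (node (playOrig w) (ownSignals i w) k) = b) := by
    intro k hk hc
    obtain ⟨m, hm, hw⟩ := exists_mem_switchEvent (r := r) hc
    exact h m (hm.trans hk) hw
  have hpre : ∀ k ≤ t + 1, pre (playSwitch C b r i w) k = pre (playOrig w) k := fun k hk =>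
    pre_playSwitch_eq' fun l hl => hno l (by omega)
  exact pre_eq_iff.1 (hpre (t + 1) le_rfl) t (Nat.lt_succ_self t)

lemma disjoint_switchEvent {m n : ℕ} (h : m < n) :
    Disjoint (switchEvent C b r i m) (switchEvent C b r i n) :=
  Set.disjoint_left.2 fun _ hm hn =>
    (mem_firstSwitch_node.1 hn).2 m h (mem_firstSwitch_node.1 hm).1

lemma pairwise_disjoint_switchEvent : Pairwise
    (Function.onFun Disjoint (switchEvent C b r i)) := fun _ _ h =>
  h.lt_or_gt.elim disjoint_switchEvent fun h => (disjoint_switchEvent h).symm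

lemma measurable_modAt {Ψ : PureStrategy X → PureStrategy X} (hΨ : Measurable Ψ) (l : Player) :
    Measurable (modAt i Ψ l) := by
  by_cases h : i = l
  · subst h; rw [modAt_self]; exact hΨ
  · rw [modAt_of_ne _ h]; exact measurable_id

lemma coe_update_mixedSwitch (σ : Player → MixedStrategy X) (l : Player) :
    ((Function.update σ i (mixedSwitch C b r (σ i)) l : MixedStrategy X) :
        Measure (PureStrategy X)) =
      (σ l : Measure (PureStrategy X)).map (modAt i (switch C b r) l) := by
  by_cases h : i = l
  · subst h; rw [modAt_self, Function.update_self, coe_mixedSwitch]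
  · rw [modAt_of_ne _ h, Function.update_of_ne (Ne.symm h), Measure.map_id]

variable [Fintype X] [MeasurableSpace X] [MeasurableSingletonClass X]

lemma measurableSet_switchEvent (m : ℕ) : MeasurableSet (switchEvent C b r i m) :=
  measurableSet_histEvent (measurable_modAt (measurable_switch C b r))
    fun _ _ => measurableSet_firstSwitch C b _

/-- The payoff difference in period `t + 1` on the draws at which player `i` first switches at
the private history of length `m`. -/
noncomputable def switchGain (f : State → PMF X) (σ : Player → MixedStrategy X) (c : ℝ)
    (C : PrivHist X → Prop) (b : Act) (r : PureStrategy X) (i : Player) (θ : State) (m t : ℕ) : ℝ :=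
  ∫ w in switchEvent C b r i m, (stagePayoff c (playSwitch C b r i w t) θ i -
    stagePayoff c (playOrig w t) θ i) ∂drawLaw f σ θ

lemma integrable_playSwitch (f : State → PMF X) (σ : Player → MixedStrategy X) {c : ℝ}
    (hc : c ∈ Set.Ioo (0 : ℝ) 1) (θ θ' : State) (t : ℕ) :
    Integrable (fun w => stagePayoff c (playSwitch C b r i w t) θ i) (drawLaw f σ θ') :=
  integrable_stagePayoff (measurable_modAt (measurable_switch C b r)) f σ hc θ θ' i t

lemma integrable_playOrig (f : State → PMF X) (σ : Player → MixedStrategy X) {c : ℝ}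
    (hc : c ∈ Set.Ioo (0 : ℝ) 1) (θ θ' : State) (t : ℕ) :
    Integrable (fun w => stagePayoff c (playOrig w t) θ i) (drawLaw f σ θ') :=
  integrable_stagePayoff (Φ := fun _ => id) (fun _ => measurable_id) f σ hc θ θ' i t

/-- The first-switch events are disjoint, and off those up to time `t` the two plays agree in that
period. -/
lemma meanPayoff_sub_eq_sum (f : State → PMF X) (σ : Player → MixedStrategy X) {c : ℝ}
    (hc : c ∈ Set.Ioo (0 : ℝ) 1) (θ : State) (t : ℕ) :
    meanPayoff f σ c (modAt i (switch C b r)) θ i t - meanPayoff f σ c (fun _ => id) θ i t =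
      ∑ m ∈ Finset.range (t + 1), switchGain f σ c C b r i θ m t := by
  have hint : Integrable (fun w => stagePayoff c (playSwitch C b r i w t) θ i -
      stagePayoff c (playOrig w t) θ i) (drawLaw f σ θ) :=
    (integrable_playSwitch f σ hc θ θ t).sub (integrable_playOrig f σ hc θ θ t)
  change (∫ w, stagePayoff c (playSwitch C b r i w t) θ i ∂drawLaw f σ θ) -
    ∫ w, stagePayoff c (playOrig w t) θ i ∂drawLaw f σ θ = _
  unfold switchGain
  rw [← integral_sub (integrable_playSwitch f σ hc θ θ t) (integrable_playOrig f σ hc θ θ t),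
    ← integral_biUnion_finset (Finset.range (t + 1)) (fun m _ => measurableSet_switchEvent m)
      (fun m _ n _ h => pairwise_disjoint_switchEvent h) fun m _ => hint.integrableOn]
  refine (setIntegral_eq_integral_of_forall_compl_eq_zero fun w hw => ?_).symm
  rw [playSwitch_eq_of_forall_notMem, sub_self]
  intro m hm hmem
  exact hw (Set.mem_biUnion (Finset.mem_coe.2 (Finset.mem_range.2 (Nat.lt_succ_of_le hm))) hmem)

/-- Lower bounds on the gains from switching in each period add up to a lower bound on the gain in
the long-run payoff. -/
lemma payoff_add_le {p₀ : ℝ} (hp₀ : p₀ ∈ Set.Ioo (0 : ℝ) 1) (f : State → PMF X)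
    (σ : Player → MixedStrategy X) {c δ M : ℝ} (hc : c ∈ Set.Ioo (0 : ℝ) 1)
    (hδ : δ ∈ Set.Ioo (0 : ℝ) 1) {A lam : ℕ → ℝ} (hA0 : ∀ m, 0 ≤ A m) (hA1 : ∀ m, A m ≤ 1)
    (hlam : ∀ k, |lam k| ≤ M)
    (h : ∀ m k, A m * lam k ≤ p₀ * switchGain f σ c C b r i State.H m (m + k) +
      (1 - p₀) * switchGain f σ c C b r i State.L m (m + k)) :
    payoff p₀ f c δ σ i + (1 - δ) * ((∑' m, δ ^ m * A m) * ∑' k, δ ^ k * lam k) ≤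
      payoff p₀ f c δ (Function.update σ i (mixedSwitch C b r (σ i))) i := by
  rw [payoff_eq_tsum hp₀ f hc hδ (Φ := fun _ => id) (fun _ => measurable_id) (σ := σ)
      (fun l => Measure.map_id.symm) i,
    payoff_eq_tsum hp₀ f hc hδ (measurable_modAt (measurable_switch C b r))
      (coe_update_mixedSwitch σ) i, ← mul_add]
  refine mul_le_mul_of_nonneg_left ?_ (by linarith [hδ.2])
  have hs1 := summable_priorMean hp₀ f σ hc hδ (fun _ => id) i
  have hs2 := summable_priorMean hp₀ f σ hc hδ (modAt i (switch C b r)) i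
  have hd : Summable fun t => δ ^ t * (priorMean p₀ f σ c (modAt i (switch C b r)) i t -
      priorMean p₀ f σ c (fun _ => id) i t) := by
    simpa only [mul_sub] using hs2.sub hs1
  have hconv := conv_le_tsum hδ hA0 hA1 hlam hd fun t => by
    have hrw : priorMean p₀ f σ c (modAt i (switch C b r)) i t -
        priorMean p₀ f σ c (fun _ => id) i t =
        p₀ * (meanPayoff f σ c (modAt i (switch C b r)) State.H i t -
          meanPayoff f σ c (fun _ => id) State.H i t) +
        (1 - p₀) * (meanPayoff f σ c (modAt i (switch C b r)) State.L i t -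
          meanPayoff f σ c (fun _ => id) State.L i t) := by
      unfold priorMean; ring
    rw [hrw, meanPayoff_sub_eq_sum f σ hc, meanPayoff_sub_eq_sum f σ hc, Finset.mul_sum,
      Finset.mul_sum, ← Finset.sum_add_distrib]
    refine Finset.sum_le_sum fun m hm => ?_
    have := h m (t - m)
    rwa [Nat.add_sub_cancel' (Nat.lt_succ_iff.1 (Finset.mem_range.1 hm))] at this
  have : ∑' t, δ ^ t * priorMean p₀ f σ c (modAt i (switch C b r)) i t =
      ∑' t, δ ^ t * priorMean p₀ f σ c (fun _ => id) i t +
      ∑' t, δ ^ t * (priorMean p₀ f σ c (modAt i (switch C b r)) i t -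
        priorMean p₀ f σ c (fun _ => id) i t) := by
    rw [← Summable.tsum_add hs1 hd]
    exact tsum_congr fun t => by ring
  rw [this]
  linarith

end Switching

/-! ### Discounted series -/

section Series

variable {δ : ℝ}

lemma hasSum_initial (δ α : ℝ) : HasSum (fun k => δ ^ k * if k = 0 then α else 0) α := by
  have := hasSum_single (f := fun k => δ ^ k * if k = 0 then α else 0) 0
    (fun k hk => by simp [hk])
  simpa using this

lemma hasSum_const (hδ : δ ∈ Set.Ioo (0 : ℝ) 1) (κ : ℝ) :
    HasSum (fun k => δ ^ k * κ) (κ / (1 - δ)) := by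
  have := (hasSum_geometric_of_lt_one hδ.1.le hδ.2).mul_right κ
  rwa [inv_mul_eq_div] at this

lemma hasSum_tail (hδ : δ ∈ Set.Ioo (0 : ℝ) 1) (T₀ : ℕ) :
    HasSum (fun k => δ ^ k * if T₀ < k then (1 : ℝ) else 0) (δ ^ (T₀ + 1) / (1 - δ)) := by
  have h0 : ∑ k ∈ Finset.range (T₀ + 1), (δ ^ k * if T₀ < k then (1 : ℝ) else 0) = 0 := by
    refine Finset.sum_eq_zero fun k hk => ?_
    rw [if_neg (by have := Finset.mem_range.1 hk; omega), mul_zero]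
  have h1 := (hasSum_geometric_of_lt_one hδ.1.le hδ.2).mul_left (δ ^ (T₀ + 1))
  rw [← div_eq_mul_inv] at h1
  have hfun : (fun k => δ ^ (k + (T₀ + 1)) * if T₀ < k + (T₀ + 1) then (1 : ℝ) else 0) =
      fun k => δ ^ (T₀ + 1) * δ ^ k := by
    funext k
    rw [if_pos (by omega), mul_one, add_comm, pow_add]
  rw [← hfun] at h1
  have h2 := (hasSum_nat_add_iff (f := fun k => δ ^ k * if T₀ < k then (1 : ℝ) else 0)
    (T₀ + 1)).1 h1
  rwa [h0, add_zero] at h2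

lemma eq_zero_of_tsum_nonpos {A : ℕ → ℝ} (hδ : δ ∈ Set.Ioo (0 : ℝ) 1) (hA0 : ∀ m, 0 ≤ A m)
    (hA1 : ∀ m, A m ≤ 1) (h : ∑' m, δ ^ m * A m ≤ 0) (m : ℕ) : A m = 0 := by
  have hs : Summable fun m => δ ^ m * A m :=
    Summable.of_nonneg_of_le (fun m => mul_nonneg (pow_nonneg hδ.1.le m) (hA0 m))
      (fun m => mul_le_of_le_one_right (pow_nonneg hδ.1.le m) (hA1 m))
      (summable_geometric_of_lt_one hδ.1.le hδ.2)
  have h1 := hs.le_tsum m fun k _ => mul_nonneg (pow_nonneg hδ.1.le k) (hA0 k)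
  have h2 : 0 < δ ^ m := pow_pos hδ.1 m
  have h3 := hA0 m
  by_contra hne
  have : 0 < δ ^ m * A m := mul_pos h2 (lt_of_le_of_ne h3 (Ne.symm hne))
  linarith

end Series

lemma bothI_iff {i j : Player} (hij : i ≠ j) {a : Profile} : a = bothI ↔ a i = Act.I ∧ a j = Act.I := by
  refine ⟨fun h => by subst h; exact ⟨rfl, rfl⟩, fun ⟨h1, h2⟩ => funext fun l => ?_⟩
  rcases eq_or_eq_of_ne hij l with rfl | rfl
  · exact h1
  · exact h2

/-! ### Profitability of the two deviations -/

section Gains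

variable {X : Type*} {f : State → PMF X} {p₀ c δ ε κ : ℝ} {T : ℕ → ℕ}
  {σ : Player → MixedStrategy X} {i j : Player}

lemma ae_strategy_mem [MeasurableSpace X] (f : State → PMF X) {σ : Player → MixedStrategy X} {θ : State} {l : Player}
    (h : ∀ᵐ s ∂(σ l : Measure (PureStrategy X)), s ∈ pureCoolOff X T) :
    ∀ᵐ w ∂drawLaw f σ θ, w.2 l ∈ pureCoolOff X T := by
  have h1 : ∀ᵐ s ∂Measure.pi fun l => (σ l : Measure (PureStrategy X)), s l ∈ pureCoolOff X T :=
    (measurePreserving_eval (fun l => (σ l : Measure (PureStrategy X))) l).quasiMeasurePreserving.ae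
      h
  exact Measure.quasiMeasurePreserving_snd.ae h1

variable [Fintype X]

lemma switchEvent_isInv {w : Draws X} {m : ℕ} {r : PureStrategy X} {b : Act} {p p' : ℝ}
    {g g' : X → ℝ} {ν : Measure (PureStrategy X)}
    (h : w ∈ switchEvent (Confident T κ p g p' g' j ν) b r i m) :
    IsInv T m (pre (playSwitch (Confident T κ p g p' g' j ν) b r i w) m) ∧
      ¬ CoolOffViolated T (pre (playSwitch (Confident T κ p g p' g' j ν) b r i w) m) :=
  ⟨(mem_firstSwitch_node.1 h).1.1.1, (mem_firstSwitch_node.1 h).1.1.2.1⟩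

/-- After a deviation to `N` at an investment history, the player abstains while the players cool
off. -/
lemma playOrig_eq_N {w : Draws X} {m k T₀ : ℕ} (hT₀ : ∀ n, T₀ ≤ T n) (hk : k ≤ T₀)
    (hs : w.2 i ∈ pureCoolOff X T) {r : PureStrategy X}
    (hw : w ∈ switchEvent (High f p₀ T κ j (σ j)) Act.N r i m) :
    playOrig w (m + k) i = Act.N := by
  have hm := playOrig_of_mem_switchEvent hw
  -- The case `k = 0` is the choice of `N` itself and the next `T₀` periods lie in the cool-off
  -- phase, so `T₀ + 1` periods pay nothing.
  rcases k with _ | k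
  · exact hm
  · have hinv := (switchEvent_isInv hw).1
    have hpre := pre_eq_of_mem_switchEvent hw
    rw [show playSwitch (Confident T κ p₀ (sig f State.H) (1 - p₀) (sig f State.L) j (σ j)) Act.N
      r i w = playSwitch (High f p₀ T κ j (σ j)) Act.N r i w from rfl, hpre] at hinv
    have hne : playOrig w m ≠ bothI := fun h => by rw [h] at hm; simp [bothI] at hm
    have hcool := not_isInv_of_le hinv hne (k := k) (lt_of_lt_of_le (by omega) (hT₀ (m + 1)))
    rw [playOrig_apply, show m + (k + 1) = m + 1 + k by omega]
    exact hs _ _ _ (Or.inl hcool)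

variable [MeasurableSpace X] [MeasurableSingletonClass X]

lemma sub_le_switchGain {C : PrivHist X → Prop} {b : Act} {r : PureStrategy X}
    (hc : c ∈ Set.Ioo (0 : ℝ) 1) {θ : State} {m t : ℕ} {α : ℝ}
    (h : ∀ᵐ w ∂drawLaw f σ θ, w ∈ switchEvent C b r i m →
      α ≤ stagePayoff c (playSwitch C b r i w t) θ i - stagePayoff c (playOrig w t) θ i) :
    α * (drawLaw f σ θ).real (switchEvent C b r i m) ≤ switchGain f σ c C b r i θ m t := by
  have h1 := setIntegral_mono_on_ae (μ := drawLaw f σ θ) (s := switchEvent C b r i m)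
    (f := fun _ => α) (integrable_const α).integrableOn
    (((integrable_playSwitch (C := C) (b := b) (r := r) (i := i) f σ hc θ θ t).sub
    (integrable_playOrig (i := i) f σ hc θ θ t)).integrableOn) (measurableSet_switchEvent m) h
  rw [setIntegral_const, smul_eq_mul, mul_comm] at h1
  exact h1

/-- In the low state, always investing after the switch costs at most one per period. -/
lemma neg_le_switchGain_L {C : PrivHist X → Prop} {b : Act} {r : PureStrategy X}
    (hc : c ∈ Set.Ioo (0 : ℝ) 1) (m t : ℕ) :
    -1 * (drawLaw f σ State.L).real (switchEvent C b r i m) ≤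
      switchGain f σ c C b r i State.L m t :=
  sub_le_switchGain hc (Filter.Eventually.of_forall fun w _ => by
    have := neg_one_le_stagePayoff hc.2.le (playSwitch C b r i w t) State.L i
    have := stagePayoff_L_nonpos hc.1.le (playOrig w t) i
    linarith)

/-- A first switch occurs only where the player is confident, so the odds bound passes from private
histories to the event. -/
lemma switchEvent_confident_le {r : PureStrategy X} {b : Act} {p p' : ℝ} {θ θ' : State}
    (hij : i ≠ j) (m : ℕ) :
    p' * (drawLaw f σ θ').real
      (switchEvent (Confident T κ p (sig f θ) p' (sig f θ') j (σ j)) b r i m) ≤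
    κ * (p * (drawLaw f σ θ).real
      (switchEvent (Confident T κ p (sig f θ) p' (sig f θ') j (σ j)) b r i m)) :=
  confident_histEvent_le (measurable_modAt (measurable_switch _ b r)) hij (modAt_of_ne _ hij)
    (fun _ _ => measurableSet_firstSwitch _ b _) fun _ _ _ hs => hs.1.1.2.2

/-- In the high state, the payoff from always investing after a switch is nonnegative in every
period, and substantial in the first. -/
lemma setIntegral_alwaysInvest (hf : ∀ θ x, 0 < f θ x)
    (hij : i ≠ j) (hσj : σ j ∈ coolOffStrategies f T ε j) (hε : 0 ≤ 1 - ε - c) (m k : ℕ) :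
    (if k = 0 then 1 - ε - c else 0) * (drawLaw f σ State.H).real
      (switchEvent (High f p₀ T κ j (σ j)) Act.N (alwaysInvest X T) i m) ≤
    ∫ w in switchEvent (High f p₀ T κ j (σ j)) Act.N (alwaysInvest X T) i m,
      stagePayoff c (playSwitch (High f p₀ T κ j (σ j)) Act.N (alwaysInvest X T) i w (m + k))
        State.H i ∂drawLaw f σ State.H := by
  set C := High f p₀ T κ j (σ j) with hC
  set r := alwaysInvest X T with hr
  set S := switchEvent C Act.N r i m with hS
  have hΦ : ∀ l, Measurable (modAt i (switch C Act.N r) l) :=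
    measurable_modAt (measurable_switch C Act.N r)
  -- Recording the switch at length `m` through `trunc` makes the event readable from player `i`'s
  -- private history at length `m + k`, so that the opponent's constraint applies to it.
  set B : ActHist (m + k) → (Fin (m + k + 1) → X) → Set (PureStrategy X) := fun a z =>
    {s | (IsInv T (m + k) a ∧ ¬ CoolOffViolated T a) ∧
      s ∈ firstSwitch C Act.N (trunc ⟨m + k, a, z⟩ m (Nat.le_add_right m k))} with hB
  have hBm : ∀ a z, MeasurableSet (B a z) := fun a z =>
    (MeasurableSet.const _).inter (measurableSet_firstSwitch C Act.N _)
  set E := histEvent (modAt i (switch C Act.N r)) i B with hE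
  set F : Set (Draws X) := {w | playSwitch C Act.N r i w (m + k) j = Act.I} with hF
  have hmemE : ∀ w, w ∈ E ↔ (IsInv T (m + k) (pre (playSwitch C Act.N r i w) (m + k)) ∧
      ¬ CoolOffViolated T (pre (playSwitch C Act.N r i w) (m + k))) ∧ w ∈ S := fun w => Iff.rfl
  have hEm : MeasurableSet E := measurableSet_histEvent hΦ hBm
  have hFm : MeasurableSet F :=
    ((measurable_pi_apply j).comp (measurable_playMod hΦ (m + k))) (measurableSet_singleton Act.I)
  have hEF : (1 - ε) * (drawLaw f σ State.H).real E ≤ (drawLaw f σ State.H).real (E ∩ F) :=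
    mul_histEvent_le hf hΦ hij (modAt_of_ne _ hij) hBm hσj fun a z s hs => hs.1
  -- After the switch, player `i` invests exactly on `E`, pays `c` there, and earns `1` where the
  -- opponent invests as well.
  have hind : S.indicator (fun w => stagePayoff c (playSwitch C Act.N r i w (m + k)) State.H i) =
      fun w => (E ∩ F).indicator 1 w - c * E.indicator 1 w := by
    funext w
    by_cases hw : w ∈ S
    · rw [Set.indicator_of_mem hw]
      have hact := playSwitch_of_mem_switchEvent hw (Nat.le_add_right m k)
      by_cases hJ : IsInv T (m + k) (pre (playSwitch C Act.N r i w) (m + k)) ∧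
          ¬ CoolOffViolated T (pre (playSwitch C Act.N r i w) (m + k))
      · have hwE : w ∈ E := (hmemE w).2 ⟨hJ, hw⟩
        have hI : playSwitch C Act.N r i w (m + k) i = Act.I := hact.trans (if_pos hJ)
        rw [Set.indicator_of_mem hwE]
        by_cases hwF : w ∈ F
        · have hb := (bothI_iff hij).2 ⟨hI, hwF⟩
          rw [Set.indicator_of_mem (show w ∈ E ∩ F from ⟨hwE, hwF⟩), hb]
          simp [stagePayoff, bothI]
        · rw [Set.indicator_of_notMem fun h : w ∈ E ∩ F => hwF h.2, stagePayoff, if_pos hI,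
            if_neg fun h => hwF ((bothI_iff hij).1 h.2).2]
          simp
      · have hN : playSwitch C Act.N r i w (m + k) i = Act.N := hact.trans (if_neg hJ)
        have hwE : w ∉ E := fun h => hJ ((hmemE w).1 h).1
        rw [stagePayoff_of_N hN, Set.indicator_of_notMem hwE,
          Set.indicator_of_notMem fun h : w ∈ E ∩ F => hwE h.1]
        simp
    · have hwE : w ∉ E := fun h => hw ((hmemE w).1 h).2
      rw [Set.indicator_of_notMem hw, Set.indicator_of_notMem hwE,
        Set.indicator_of_notMem fun h : w ∈ E ∩ F => hwE h.1]
      simp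
  have hint : ∫ w in S, stagePayoff c (playSwitch C Act.N r i w (m + k)) State.H i
      ∂drawLaw f σ State.H =
      (drawLaw f σ State.H).real (E ∩ F) - c * (drawLaw f σ State.H).real E := by
    rw [← integral_indicator (measurableSet_switchEvent m), hind, integral_sub, integral_const_mul,
      integral_indicator_one (hEm.inter hFm), integral_indicator_one hEm]
    · exact (integrable_const (1 : ℝ)).indicator (hEm.inter hFm)
    · exact ((integrable_const (1 : ℝ)).indicator hEm).const_mul c
  rw [hint]
  split_ifs with hk
  -- Switches happen only at unviolated investment histories, so at the moment of switching nothing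
  -- is lost by passing to `E`.
  · have hSE : E = S := by
      subst hk
      ext w
      rw [hmemE]
      exact ⟨fun h => h.2, fun h => ⟨switchEvent_isInv h, h⟩⟩
    rw [← hSE]
    linarith
  · have := mul_nonneg hε (measureReal_nonneg (μ := drawLaw f σ State.H) (s := E))
    linarith

/-- Switching to permanent investment when confident of the high state does not lower the payoff,
and raises it unless such switches have probability zero. -/
lemma payoff_switch_high (hf : ∀ θ x, 0 < f θ x) (hp₀ : p₀ ∈ Set.Ioo (0 : ℝ) 1)
    (hc : c ∈ Set.Ioo (0 : ℝ) 1) (hδ : δ ∈ Set.Ioo (0 : ℝ) 1) (hcal : Calibrated f p₀ c δ T ε κ)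
    (hij : i ≠ j) (hσi : ∀ᵐ s ∂(σ i : Measure (PureStrategy X)), s ∈ pureCoolOff X T)
    (hσj : σ j ∈ coolOffStrategies f T ε j) :
    ∃ Λ > 0, payoff p₀ f c δ σ i + Λ * ∑' m, δ ^ m * (p₀ * (drawLaw f σ State.H).real
      (switchEvent (High f p₀ T κ j (σ j)) Act.N (alwaysInvest X T) i m)) ≤
      payoff p₀ f c δ (Function.update σ i
        (mixedSwitch (High f p₀ T κ j (σ j)) Act.N (alwaysInvest X T) (σ i))) i := by
  obtain ⟨T₀, hT₀, hgain⟩ := hcal.gain_high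
  have hκ := hcal.kappa_pos
  have h1δ : 0 < 1 - δ := sub_pos.2 hδ.2
  have hεc : 0 ≤ 1 - ε - c := by
    have h1 : 0 < κ / (1 - δ) := by positivity
    have h2 : 0 ≤ δ ^ (T₀ + 1) / (1 - δ) := div_nonneg (pow_nonneg hδ.1.le _) h1δ.le
    linarith
  set S := switchEvent (High f p₀ T κ j (σ j)) Act.N (alwaysInvest X T) i
  -- Per unit of `H`-probability of switching: the immediate gain, the most that the original
  -- strategy can earn after the cool-off, and the loss in state `L` converted by confidence.
  set lam : ℕ → ℝ := fun k =>
    (if k = 0 then 1 - ε - c else 0) - (if T₀ < k then (1 : ℝ) else 0) - κ with hlam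
  have hsum : ∑' k, δ ^ k * lam k = (1 - ε - c) - δ ^ (T₀ + 1) / (1 - δ) - κ / (1 - δ) := by
    have := (((hasSum_initial δ (1 - ε - c)).sub (hasSum_tail hδ T₀)).sub
      (hasSum_const hδ κ)).tsum_eq
    rw [← this]
    exact tsum_congr fun k => by rw [hlam]; ring
  have hA0 : ∀ m, 0 ≤ p₀ * (drawLaw f σ State.H).real (S m) := fun m =>
    mul_nonneg hp₀.1.le measureReal_nonneg
  refine ⟨(1 - δ) * ∑' k, δ ^ k * lam k, mul_pos h1δ (by rw [hsum]; linarith), ?_⟩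
  have key := payoff_add_le (C := High f p₀ T κ j (σ j)) (b := Act.N) (r := alwaysInvest X T)
    (i := i) hp₀ f σ hc hδ (A := fun m => p₀ * (drawLaw f σ State.H).real (S m)) (lam := lam)
    (M := 2 + κ) hA0 (fun m => mul_le_one₀ hp₀.2.le measureReal_nonneg measureReal_le_one) ?_ ?_
  · refine le_trans (le_of_eq ?_) key
    ring
  · intro k
    have := hcal.eps_pos
    have := hc.1
    simp only [hlam]
    rw [abs_le]
    constructor <;> split_ifs <;> linarith
  · intro m k
    have hL := neg_le_switchGain_L (f := f) (σ := σ) (i := i) (C := High f p₀ T κ j (σ j))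
      (b := Act.N) (r := alwaysInvest X T) hc m (m + k)
    have hconf : (1 - p₀) * (drawLaw f σ State.L).real (S m) ≤
      κ * (p₀ * (drawLaw f σ State.H).real (S m)) := switchEvent_confident_le hij m
    have hH : (drawLaw f σ State.H).real (S m) * (lam k + κ) ≤
        switchGain f σ c (High f p₀ T κ j (σ j)) Act.N (alwaysInvest X T) i State.H m (m + k) := by
      have h1 := setIntegral_alwaysInvest (p₀ := p₀) (κ := κ) hf hij hσj hεc m k
      have h2 : ∫ w in S m, stagePayoff c (playOrig w (m + k)) State.H i ∂drawLaw f σ State.H ≤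
          (if T₀ < k then (1 : ℝ) else 0) * (drawLaw f σ State.H).real (S m) := by
        have h3 := setIntegral_mono_on_ae (μ := drawLaw f σ State.H) (s := S m)
          (g := fun _ => if T₀ < k then (1 : ℝ) else 0)
          (integrable_playOrig (i := i) f σ hc State.H State.H (m + k)).integrableOn
          (integrable_const _).integrableOn (measurableSet_switchEvent m) (by
            filter_upwards [ae_strategy_mem f hσi] with w hs hw
            split_ifs with hk
            · exact stagePayoff_le_one hc.1.le _ _ _
            · rw [stagePayoff_of_N (playOrig_eq_N hT₀ (not_lt.1 hk) hs hw)])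
        rwa [setIntegral_const, smul_eq_mul, mul_comm] at h3
      rw [switchGain, integral_sub (integrable_playSwitch f σ hc _ _ _).integrableOn
        (integrable_playOrig f σ hc _ _ _).integrableOn]
      simp only [hlam]
      linarith
    have h5 := mul_le_mul_of_nonneg_left hH hp₀.1.le
    have h6 := mul_le_mul_of_nonneg_left hL (sub_nonneg.2 hp₀.2.le)
    linarith

/-- Switching to permanent abstention when confident of the low state does not lower the payoff,
and raises it unless such switches have probability zero. -/
lemma payoff_switch_low (hp₀ : p₀ ∈ Set.Ioo (0 : ℝ) 1)
    (hc : c ∈ Set.Ioo (0 : ℝ) 1) (hδ : δ ∈ Set.Ioo (0 : ℝ) 1) (hcal : Calibrated f p₀ c δ T ε κ)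
    (hij : i ≠ j) :
    ∃ Λ > 0, payoff p₀ f c δ σ i + Λ * ∑' m, δ ^ m * ((1 - p₀) * (drawLaw f σ State.L).real
      (switchEvent (Low f p₀ T κ j (σ j)) Act.I (fun _ => Act.N) i m)) ≤
      payoff p₀ f c δ (Function.update σ i
        (mixedSwitch (Low f p₀ T κ j (σ j)) Act.I (fun _ => Act.N) (σ i))) i := by
  have hκ := hcal.kappa_pos
  have h1δ : 0 < 1 - δ := sub_pos.2 hδ.2
  have hp₁ : 0 < 1 - p₀ := sub_pos.2 hp₀.2
  set S := switchEvent (Low f p₀ T κ j (σ j)) Act.I (fun _ => Act.N) i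
  -- Per unit of `L`-probability of switching: the cost `c` saved at once, less the forgone payoff
  -- of at most `1` per period in state `H`, converted by confidence.
  set lam : ℕ → ℝ := fun k => (if k = 0 then c else 0) - κ with hlam
  have hsum : ∑' k, δ ^ k * lam k = c - κ / (1 - δ) := by
    rw [← ((hasSum_initial δ c).sub (hasSum_const hδ κ)).tsum_eq]
    exact tsum_congr fun k => by rw [hlam]; ring
  have hpos : 0 < c - κ / (1 - δ) := by
    rw [sub_pos, div_lt_iff₀ h1δ]; exact hcal.gain_low
  refine ⟨(1 - δ) * ∑' k, δ ^ k * lam k, mul_pos h1δ (by rw [hsum]; exact hpos), ?_⟩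
  have key := payoff_add_le (C := Low f p₀ T κ j (σ j)) (b := Act.I) (r := fun _ => Act.N)
    (i := i) hp₀ f σ hc hδ (A := fun m => (1 - p₀) * (drawLaw f σ State.L).real (S m)) (lam := lam)
    (M := 1 + κ) (fun m => mul_nonneg hp₁.le measureReal_nonneg)
    (fun m => mul_le_one₀ (by linarith [hp₀.1]) measureReal_nonneg measureReal_le_one) ?_ ?_
  · refine le_trans (le_of_eq ?_) key
    ring
  · intro k
    have := hc.1
    have := hc.2
    simp only [hlam]
    rw [abs_le]
    constructor <;> split_ifs <;> linarith
  · intro m k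
    have hconf : p₀ * (drawLaw f σ State.H).real (S m) ≤
      κ * ((1 - p₀) * (drawLaw f σ State.L).real (S m)) := switchEvent_confident_le hij m
    have hsw : ∀ θ, ∀ w ∈ S m, stagePayoff c (playSwitch (Low f p₀ T κ j (σ j)) Act.I
        (fun _ => Act.N) i w (m + k)) θ i = 0 := fun θ w hw =>
      stagePayoff_of_N (playSwitch_of_mem_switchEvent hw (Nat.le_add_right m k))
    have hH : -1 * (drawLaw f σ State.H).real (S m) ≤ switchGain f σ c (Low f p₀ T κ j (σ j)) Act.I
        (fun _ => Act.N) i State.H m (m + k) :=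
      sub_le_switchGain hc (Filter.Eventually.of_forall fun w hw => by
        rw [hsw _ w hw]
        have := stagePayoff_le_one hc.1.le (playOrig w (m + k)) State.H i
        linarith)
    have hL : (if k = 0 then c else 0) * (drawLaw f σ State.L).real (S m) ≤
        switchGain f σ c (Low f p₀ T κ j (σ j)) Act.I (fun _ => Act.N) i State.L m (m + k) :=
      sub_le_switchGain hc (Filter.Eventually.of_forall fun w hw => by
        rw [hsw _ w hw]
        split_ifs with hk
        · subst hk
          rw [add_zero, stagePayoff_L_of_I (playOrig_of_mem_switchEvent hw)]
          linarith
        · have := stagePayoff_L_nonpos hc.1.le (playOrig w (m + k)) i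
          linarith)
    have h5 := mul_le_mul_of_nonneg_left hH hp₀.1.le
    have h6 := mul_le_mul_of_nonneg_left hL hp₁.le
    simp only [hlam]
    linarith

end Gains

/-! ### Choice of the constants and of the cool-off function -/

section Calibration

variable {X : Type*} [Fintype X]

/-- The inequality between geometric and arithmetic mean is strict at a signal where the two laws
differ. -/
lemma bhattacharyya_lt_one {f : State → PMF X} (hne : f State.H ≠ f State.L) :
    ∑ x, √(sig f State.H x * sig f State.L x) < 1 := by
  have hle : ∀ x, √(sig f State.H x * sig f State.L x) ≤
      (sig f State.H x + sig f State.L x) / 2 := fun x =>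
    Real.sqrt_le_iff.2 ⟨by linarith [sig_nonneg f State.H x, sig_nonneg f State.L x],
      by nlinarith [sq_nonneg (sig f State.H x - sig f State.L x)]⟩
  obtain ⟨x, hx⟩ : ∃ x, sig f State.H x ≠ sig f State.L x := by
    by_contra! h
    refine hne (PMF.ext fun x => ?_)
    exact (ENNReal.toReal_eq_toReal_iff' ((f State.H).apply_ne_top x)
      ((f State.L).apply_ne_top x)).1 (h x)
  have hlt : √(sig f State.H x * sig f State.L x) <
      (sig f State.H x + sig f State.L x) / 2 := by
    have hpos : 0 < (sig f State.H x - sig f State.L x) ^ 2 := by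
      have := sub_ne_zero.2 hx
      positivity
    rcases (add_nonneg (sig_nonneg f State.H x) (sig_nonneg f State.L x)).eq_or_lt with h0 | h0
    · exact absurd (by linarith [sig_nonneg f State.H x, sig_nonneg f State.L x]) hx
    · exact (Real.sqrt_lt' (by linarith)).2 (by nlinarith)
  calc _ < ∑ x, (sig f State.H x + sig f State.L x) / 2 :=
        Finset.sum_lt_sum (fun x _ => hle x) ⟨x, Finset.mem_univ x, hlt⟩
    _ = 1 := by rw [← Finset.sum_div, Finset.sum_add_distrib, sum_sig, sum_sig]; norm_num

/-- The order of choice matters: `ε` depends on `r` and `c`, then `κ` and `T₀` on `c` and `δ`, then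
`C` and `K` on the prior, `κ` and the signals, and finally each `T n` on all of these. -/
lemma exists_calibrated {f : State → PMF X} (hf : ∀ θ x, 0 < f θ x) (hne : f State.H ≠ f State.L)
    {p₀ c δ : ℝ} (hp₀ : p₀ ∈ Set.Ioo (0 : ℝ) 1) (hc : c ∈ Set.Ioo (0 : ℝ) 1)
    (hδ : δ ∈ Set.Ioo (0 : ℝ) 1) : ∃ T ε κ, Calibrated f p₀ c δ T ε κ := by
  set r := ∑ x, √(sig f State.H x * sig f State.L x) with hr
  have hr0 : 0 ≤ r := Finset.sum_nonneg fun x _ => Real.sqrt_nonneg _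
  have hr1 : r < 1 := bhattacharyya_lt_one hne
  obtain ⟨hc0, hc1⟩ := hc
  obtain ⟨hp0, hp1⟩ := hp₀
  have h1δ : 0 < 1 - δ := sub_pos.2 hδ.2
  have hd0 := hδ.1
  -- The first bound gives `(1 - ε) ^ 2 ≥ 1 - 2 ε ≥ r`. The second leaves `1 - ε - c ≥ (1 - c) / 2`,
  -- of which `κ` and `T₀` use up at most `(1 - c) / 8` each.
  set ε := min ((1 - r) / 2) ((1 - c) / 2) with hε
  have hε0 : 0 < ε := lt_min (by linarith) (by linarith)
  have hεr : ε ≤ (1 - r) / 2 := min_le_left _ _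
  have hεc : ε ≤ (1 - c) / 2 := min_le_right _ _
  set κ := min (c * (1 - δ) / 2) ((1 - c) / 8 * (1 - δ)) with hκ
  have hκ0 : 0 < κ := lt_min (by positivity) (mul_pos (by linarith) h1δ)
  have hκ1 : κ ≤ c * (1 - δ) / 2 := min_le_left _ _
  have hκ2 : κ / (1 - δ) ≤ (1 - c) / 8 := (div_le_iff₀ h1δ).2 (min_le_right _ _)
  obtain ⟨T₀, hT₀⟩ := exists_pow_lt_of_lt_one
    (show 0 < (1 - c) / 8 * (1 - δ) from mul_pos (by linarith) h1δ) hδ.2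
  have hT₀' : δ ^ (T₀ + 1) / (1 - δ) ≤ (1 - c) / 8 := by
    rw [div_le_iff₀ h1δ]
    exact (pow_le_pow_of_le_one hδ.1.le hδ.2.le (Nat.le_succ _)).trans hT₀.le
  set C := max 1 ((1 - p₀) / (κ * p₀)) with hC
  have hC1 : 1 ≤ C := le_max_left _ _
  have hCp : 1 - p₀ ≤ C * (κ * p₀) := (div_le_iff₀ (by positivity)).1 (le_max_right _ _)
  have hpos : ∀ x, 0 < sig f State.H x := fun x =>
    ENNReal.toReal_pos (hf _ x).ne' ((f _).apply_ne_top x)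
  set K := 1 + ∑ x, sig f State.L x / sig f State.H x with hK
  have hterm : ∀ x, 0 ≤ sig f State.L x / sig f State.H x := fun x =>
    div_nonneg (sig_nonneg f _ x) (hpos x).le
  have hK1 : 1 ≤ K := le_add_of_nonneg_right (Finset.sum_nonneg fun x _ => hterm x)
  have hKx : ∀ x, sig f State.L x ≤ K * sig f State.H x := fun x => by
    rw [← div_le_iff₀ (hpos x)]
    have := Finset.single_le_sum (fun x _ => hterm x) (Finset.mem_univ x)
    linarith
  have hN : ∀ n : ℕ, ∃ N, T₀ ≤ N ∧ C * K ^ (2 * (n + 1)) * r ^ N ≤ ε := by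
    intro n
    have hCK : 0 < C * K ^ (2 * (n + 1)) := by positivity
    obtain ⟨N, hN⟩ := exists_pow_lt_of_lt_one (div_pos hε0 hCK) hr1
    refine ⟨max T₀ N, le_max_left _ _, ?_⟩
    have h1 := (pow_le_pow_of_le_one hr0 hr1.le (le_max_right T₀ N)).trans hN.le
    rwa [le_div_iff₀ hCK, mul_comm] at h1
  choose T hTT₀ hT using hN
  exact ⟨T, ε, κ, {
    eps_pos := hε0
    eps_lt := by linarith
    kappa_pos := hκ0
    slack := ⟨C, K, hC1, hCp, hK1, hKx, hT⟩
    bhattacharyya_le := by nlinarith [sq_nonneg ε]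
    gain_high := ⟨T₀, hTT₀, by linarith⟩
    gain_low := by nlinarith [mul_pos hc0 h1δ] }⟩

end Calibration

/-! ### Equilibrium behaviour and convergence -/

section Equilibrium

lemma eq_zero_of_payoff_add_le {A : ℕ → ℝ} {δ : ℝ} (hδ : δ ∈ Set.Ioo (0 : ℝ) 1) (hA0 : ∀ m, 0 ≤ A m)
    (hA1 : ∀ m, A m ≤ 1) {Λ u v : ℝ} (hΛ : 0 < Λ) (h : u + Λ * ∑' m, δ ^ m * A m ≤ v)
    (huv : v ≤ u) (m : ℕ) : A m = 0 :=
  eq_zero_of_tsum_nonpos hδ hA0 hA1 (nonpos_of_mul_nonpos_right (by linarith) hΛ) m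

lemma measure_eq_zero_of_mul_real {Y : Type*} [MeasurableSpace Y] {μ : Measure Y} [IsFiniteMeasure μ] {p : ℝ} (hp : 0 < p)
    {s : Set Y} (h : p * μ.real s = 0) : μ s = 0 :=
  (measureReal_eq_zero_iff).1 ((mul_eq_zero.1 h).resolve_left hp.ne')

variable {X : Type*} [Fintype X] [MeasurableSpace X]
  {f : State → PMF X} {p₀ c δ ε κ : ℝ} {T : ℕ → ℕ} {σ : Player → MixedStrategy X} {i j : Player}

lemma ae_not_violated (hf : ∀ θ x, 0 < f θ x)
    (hσ : ∀ l, σ l ∈ coolOffStrategies f T ε l) (θ : State) :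
    ∀ᵐ w ∂drawLaw f σ θ, (∀ l t, ¬ IsInv T t (pre (playOrig w) t) → playOrig w t l = Act.N) ∧
      ∀ t, ¬ CoolOffViolated T (pre (playOrig w) t) := by
  have h : ∀ᵐ w ∂drawLaw f σ θ, ∀ l, w.2 l ∈ pureCoolOff X T :=
    ae_all_iff.2 fun l => ae_strategy_mem f ((mem_coolOffStrategies_iff hf).1 (hσ l)).1
  filter_upwards [h] with w hw
  have hN : ∀ l t, ¬ IsInv T t (pre (playOrig w) t) → playOrig w t l = Act.N := by
    intro l t ht
    rw [playOrig_apply]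
    exact hw l _ _ _ (Or.inl ht)
  refine ⟨hN, fun t => ?_⟩
  rw [violated_pre_iff]
  rintro ⟨k, -, hk, l, hl⟩
  rw [hN l k hk] at hl
  cases hl

variable [MeasurableSingletonClass X]

/-- In equilibrium, players who are confident of the high state invest. -/
lemma switchEvent_high_null (hf : ∀ θ x, 0 < f θ x) (hp₀ : p₀ ∈ Set.Ioo (0 : ℝ) 1)
    (hc : c ∈ Set.Ioo (0 : ℝ) 1) (hδ : δ ∈ Set.Ioo (0 : ℝ) 1) (hcal : Calibrated f p₀ c δ T ε κ)
    (hij : i ≠ j) (heq : IsRestrictedEquilibrium p₀ f c δ (coolOffStrategies f T ε) σ) (m : ℕ) :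
    drawLaw f σ State.H
      (switchEvent (High f p₀ T κ j (σ j)) Act.N (alwaysInvest X T) i m) = 0 := by
  have hσi := ((mem_coolOffStrategies_iff hf).1 (heq.1 i)).1
  obtain ⟨Λ, hΛ, h⟩ := payoff_switch_high hf hp₀ hc hδ hcal hij hσi (heq.1 j)
  refine measure_eq_zero_of_mul_real hp₀.1 (eq_zero_of_payoff_add_le hδ
    (fun m => mul_nonneg hp₀.1.le measureReal_nonneg)
    (fun m => mul_le_one₀ hp₀.2.le measureReal_nonneg measureReal_le_one) hΛ h
    (heq.2 i _ (mixedSwitch_high_mem hf hp₀ hcal hσi (heq.1 j))) m)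

/-- In equilibrium, players who are confident of the low state do not invest. -/
lemma switchEvent_low_null (hf : ∀ θ x, 0 < f θ x) (hp₀ : p₀ ∈ Set.Ioo (0 : ℝ) 1)
    (hc : c ∈ Set.Ioo (0 : ℝ) 1) (hδ : δ ∈ Set.Ioo (0 : ℝ) 1) (hcal : Calibrated f p₀ c δ T ε κ)
    (hij : i ≠ j) (heq : IsRestrictedEquilibrium p₀ f c δ (coolOffStrategies f T ε) σ) (m : ℕ) :
    drawLaw f σ State.L
      (switchEvent (Low f p₀ T κ j (σ j)) Act.I (fun _ => Act.N) i m) = 0 := by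
  have hσi := ((mem_coolOffStrategies_iff hf).1 (heq.1 i)).1
  have hN : (fun _ => Act.N : PureStrategy X) ∈ pureCoolOff X T := fun _ _ _ _ => rfl
  obtain ⟨Λ, hΛ, h⟩ := payoff_switch_low (σ := σ) hp₀ hc hδ hcal hij
  -- Abstaining when confident of `L` may breach the investment constraint. The switch to investment
  -- when confident of `H` is applied on top: it restores feasibility and does not lower the payoff,
  -- so the equilibrium inequality still bounds the gain from abstaining. Confidence depends on the
  -- opponent's strategy only, which is unchanged.
  set σ' := Function.update σ i
    (mixedSwitch (Low f p₀ T κ j (σ j)) Act.I (fun _ => Act.N) (σ i)) with hσ'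
  have hσ'j : σ' j = σ j := Function.update_of_ne hij.symm _ _
  have hσ'i : ∀ᵐ s ∂(σ' i : Measure (PureStrategy X)), s ∈ pureCoolOff X T := by
    rw [hσ', Function.update_self]
    exact ae_mixedSwitch_mem hN hσi
  have hσ'j' : σ' j ∈ coolOffStrategies f T ε j := by rw [hσ'j]; exact heq.1 j
  obtain ⟨Λ', hΛ', h'⟩ := payoff_switch_high hf hp₀ hc hδ hcal hij hσ'i hσ'j'
  have hle := heq.2 i _ (mixedSwitch_high_mem (i := i) hf hp₀ hcal hσ'i hσ'j')
  have hidem : ∀ τ, Function.update σ' i τ = Function.update σ i τ := fun τ => by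
    rw [hσ', Function.update_idem]
  rw [hidem] at h'
  have hnn : 0 ≤ Λ' * ∑' m, δ ^ m * (p₀ * (drawLaw f σ' State.H).real
      (switchEvent (High f p₀ T κ j (σ' j)) Act.N (alwaysInvest X T) i m)) :=
    mul_nonneg hΛ'.le (tsum_nonneg fun m => mul_nonneg (pow_nonneg hδ.1.le m)
      (mul_nonneg hp₀.1.le measureReal_nonneg))
  refine measure_eq_zero_of_mul_real (sub_pos.2 hp₀.2) (eq_zero_of_payoff_add_le hδ
    (fun m => mul_nonneg (sub_nonneg.2 hp₀.2.le) measureReal_nonneg)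
    (fun m => mul_le_one₀ (by linarith [hp₀.1]) measureReal_nonneg measureReal_le_one) hΛ h
    (by linarith) m)

/-- Almost surely, every player is eventually always confident of the true state. -/
lemma ae_eventually_confident {p p' : ℝ} (hp : 0 < p) (hp' : 0 < p') (hκ : 0 < κ) {θ θ' : State}
    (hr : ∑ x, √(sig f θ x * sig f θ' x) < 1) (hij : i ≠ j) :
    ∀ᵐ w ∂drawLaw f σ θ, ∃ n, ∀ t ≥ n,
      stateWeight p' (sig f θ') j (σ j) (node (playOrig w) (ownSignals i w) t) ≤
        κ * stateWeight p (sig f θ) j (σ j) (node (playOrig w) (ownSignals i w) t) := by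
  have hr0 : 0 ≤ ∑ x, √(sig f θ x * sig f θ' x) :=
    Finset.sum_nonneg fun x _ => Real.sqrt_nonneg _
  have hsum : Summable fun t : ℕ => (drawLaw f σ θ).real
      (histEvent (fun _ => id) i fun (a : ActHist t) z => {_s |
        ¬ stateWeight p' (sig f θ') j (σ j) ⟨t, a, z⟩ ≤
        κ * stateWeight p (sig f θ) j (σ j) ⟨t, a, z⟩}) := by
    refine Summable.of_nonneg_of_le (fun t => measureReal_nonneg)
      (fun t => not_confident_le hij hp hp' hκ t) (Summable.mul_left _ ?_)
    exact (summable_nat_add_iff 1).2 (summable_geometric_of_lt_one hr0 hr)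
  have htop := hsum.tsum_ofReal_ne_top
  rw [tsum_congr fun t => ofReal_measureReal] at htop
  -- Borel–Cantelli.
  filter_upwards [ae_eventually_notMem htop] with w hw
  obtain ⟨n, hn⟩ := Filter.eventually_atTop.1 hw
  exact ⟨n, fun t ht => not_not.1 (hn t ht)⟩

lemma ae_eventually_bothI (hf : ∀ θ x, 0 < f θ x) (hne : f State.H ≠ f State.L)
    (hp₀ : p₀ ∈ Set.Ioo (0 : ℝ) 1)
    (hc : c ∈ Set.Ioo (0 : ℝ) 1) (hδ : δ ∈ Set.Ioo (0 : ℝ) 1) (hcal : Calibrated f p₀ c δ T ε κ)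
    (heq : IsRestrictedEquilibrium p₀ f c δ (coolOffStrategies f T ε) σ) :
    ∀ᵐ w ∂drawLaw f σ State.H, ∃ n, ∀ t ≥ n, playOrig w t = bothI := by
  have hplayer : ∀ᵐ w ∂drawLaw f σ State.H, ∀ i : Player, ∃ n, ∀ t ≥ n,
      IsInv T t (pre (playOrig w) t) → playOrig w t i = Act.I := by
    refine ae_all_iff.2 fun i => ?_
    obtain ⟨j, hij⟩ := exists_ne i
    have hnull : ∀ᵐ w ∂drawLaw f σ State.H, ∀ m,
        w ∉ switchEvent (High f p₀ T κ j (σ j)) Act.N (alwaysInvest X T) i m :=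
      ae_all_iff.2 fun m => measure_eq_zero_iff_ae_notMem.1
        (switchEvent_high_null hf hp₀ hc hδ hcal hij heq m)
    filter_upwards [hnull, ae_not_violated hf heq.1 State.H,
      ae_eventually_confident (σ := σ) hp₀.1 (sub_pos.2 hp₀.2) hcal.kappa_pos
        (bhattacharyya_lt_one hne) hij] with w h1 h2 h3
    obtain ⟨n, hn⟩ := h3
    refine ⟨n, fun t ht hinv => ?_⟩
    rw [eq_I_iff]
    intro hN
    rw [playOrig_apply] at hN
    obtain ⟨m, -, hm⟩ := exists_mem_switchEvent (C := High f p₀ T κ j (σ j))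
      (r := alwaysInvest X T) ⟨⟨hinv, h2.2 t, hn t ht⟩, hN⟩
    exact h1 m hm
  filter_upwards [hplayer] with w hw
  choose n hn using hw
  refine eventually_bothI (T := T) (t₀ := Finset.univ.sup n) fun t ht hinv => funext fun i => ?_
  exact hn i t ((Finset.le_sup (Finset.mem_univ i)).trans ht) hinv

lemma ae_eventually_bothN (hf : ∀ θ x, 0 < f θ x) (hne : f State.H ≠ f State.L)
    (hp₀ : p₀ ∈ Set.Ioo (0 : ℝ) 1)
    (hc : c ∈ Set.Ioo (0 : ℝ) 1) (hδ : δ ∈ Set.Ioo (0 : ℝ) 1) (hcal : Calibrated f p₀ c δ T ε κ)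
    (heq : IsRestrictedEquilibrium p₀ f c δ (coolOffStrategies f T ε) σ) :
    ∀ᵐ w ∂drawLaw f σ State.L, ∃ n, ∀ t ≥ n, playOrig w t = bothN := by
  have hr : ∑ x, √(sig f State.L x * sig f State.H x) < 1 := by
    simpa only [mul_comm] using bhattacharyya_lt_one hne
  have hplayer : ∀ᵐ w ∂drawLaw f σ State.L, ∀ i : Player, ∃ n, ∀ t ≥ n,
      playOrig w t i = Act.N := by
    refine ae_all_iff.2 fun i => ?_
    obtain ⟨j, hij⟩ := exists_ne i
    have hnull : ∀ᵐ w ∂drawLaw f σ State.L, ∀ m,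
        w ∉ switchEvent (Low f p₀ T κ j (σ j)) Act.I (fun _ => Act.N) i m :=
      ae_all_iff.2 fun m => measure_eq_zero_iff_ae_notMem.1
        (switchEvent_low_null hf hp₀ hc hδ hcal hij heq m)
    filter_upwards [hnull, ae_not_violated hf heq.1 State.L,
      ae_eventually_confident (σ := σ) (sub_pos.2 hp₀.2) hp₀.1 hcal.kappa_pos hr hij]
      with w h1 h2 h3
    obtain ⟨n, hn⟩ := h3
    refine ⟨n, fun t ht => ?_⟩
    -- At an investment history, investing would put the draw into one of the null switch events; at
    -- a cool-off history `N` is prescribed.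
    by_cases hinv : IsInv T t (pre (playOrig w) t)
    · rw [eq_N_iff]
      intro hI
      rw [playOrig_apply] at hI
      obtain ⟨m, -, hm⟩ := exists_mem_switchEvent (C := Low f p₀ T κ j (σ j))
        (r := fun _ => Act.N) ⟨⟨hinv, h2.2 t, hn t ht⟩, hI⟩
      exact h1 m hm
    · exact h2.1 i t hinv
  filter_upwards [hplayer] with w hw
  choose n hn using hw
  exact ⟨Finset.univ.sup n, fun t ht => funext fun i =>
    hn i t ((Finset.le_sup (Finset.mem_univ i)).trans ht)⟩

lemma ae_pathLawGiven {θ : State} {b : Profile}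
    (h : ∀ᵐ w ∂drawLaw f σ θ, ∃ n, ∀ t ≥ n, playOrig w t = b) :
    ∀ᵐ ω ∂pathLawGiven f σ θ, ω.1 = θ ∧ Filter.Tendsto ω.2.2 Filter.atTop (nhds b) := by
  have hmeas : MeasurableSet {ω : PathSpace X | ω.1 = θ ∧ ∃ n, ∀ t ≥ n, ω.2.2 t = b} := by
    suffices h : MeasurableSet {ω : PathSpace X | ∃ n, ∀ t ≥ n, ω.2.2 t = b} from
      (measurable_fst (measurableSet_singleton θ)).inter h
    simp only [Set.ofPred_exists, Set.ofPred_forall]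
    refine MeasurableSet.iUnion fun n => MeasurableSet.iInter fun t => MeasurableSet.iInter fun _ =>
      ?_
    have ht : Measurable fun ω : PathSpace X => ω.2.2 t := by fun_prop
    exact ht (measurableSet_singleton b)
  have h1 : ∀ᵐ ω ∂pathLawGiven f σ θ, ω.1 = θ ∧ ∃ n, ∀ t ≥ n, ω.2.2 t = b := by
    change ∀ᵐ ω ∂(drawLaw f σ θ).map (outcome θ), ω.1 = θ ∧ ∃ n, ∀ t ≥ n, ω.2.2 t = b
    rw [ae_map_iff (measurable_outcome θ).aemeasurable hmeas]
    filter_upwards [h] with w hw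
    exact ⟨rfl, hw⟩
  filter_upwards [h1] with ω ⟨hθ, n, hn⟩
  exact ⟨hθ, tendsto_atTop_of_eventually_const hn⟩

end Equilibrium

end CoolOff

theorem mainTheorem1 {X : Type*} [Fintype X] [MeasurableSpace X] [MeasurableSingletonClass X]
    (p₀ : ℝ) (hp₀ : p₀ ∈ Set.Ioo (0 : ℝ) 1)
    (f : CoolOff.State → PMF X) (hfull : ∀ θ x, 0 < f θ x)
    (hne : f CoolOff.State.H ≠ f CoolOff.State.L)
    (c δ : ℝ) (hc : c ∈ Set.Ioo (0 : ℝ) 1) (hδ : δ ∈ Set.Ioo (0 : ℝ) 1) :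
    ∃ (T : ℕ → ℕ) (ε : ℝ), 0 < ε ∧
      ∀ σ : CoolOff.Player → CoolOff.MixedStrategy X,
        CoolOff.IsRestrictedEquilibrium p₀ f c δ (CoolOff.coolOffStrategies f T ε) σ →
        ∀ᵐ ω ∂(CoolOff.pathLaw p₀ f σ),
          (ω.1 = CoolOff.State.H →
            Filter.Tendsto ω.2.2 Filter.atTop (nhds CoolOff.bothI)) ∧
          (ω.1 = CoolOff.State.L →
            Filter.Tendsto ω.2.2 Filter.atTop (nhds CoolOff.bothN)) := by
  obtain ⟨T, ε, κ, hcal⟩ := CoolOff.exists_calibrated hfull hne hp₀ hc hδ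
  refine ⟨T, ε, hcal.eps_pos, fun σ heq => ?_⟩
  have hH := CoolOff.ae_pathLawGiven
    (CoolOff.ae_eventually_bothI hfull hne hp₀ hc hδ hcal heq)
  have hL := CoolOff.ae_pathLawGiven
    (CoolOff.ae_eventually_bothN hfull hne hp₀ hc hδ hcal heq)
  rw [CoolOff.pathLaw, MeasureTheory.ae_add_measure_iff]
  constructor
  · refine MeasureTheory.Measure.ae_smul_measure ?_ _
    filter_upwards [hH] with ω hω
    exact ⟨fun _ => hω.2, fun h => absurd (hω.1.symm.trans h) (by decide)⟩
  · refine MeasureTheory.Measure.ae_smul_measure ?_ _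
    filter_upwards [hL] with ω hω
    exact ⟨fun h => absurd (hω.1.symm.trans h) (by decide), fun _ => hω.2⟩
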